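/- Conventions. "Smooth" means $C^\infty$. A submanifold of $\mathbb R^n$ is an embedded smooth submanifold, not necessarily connected, all of whose components have the same dimension. For submanifolds $X,Y\subset\mathbb R^n$, $X$ is Whitney regular over $Y$ if for every $y\in Y$ and all sequences $(x_i)$ in $X$, $(y_i)$ in $Y$ with $x_i\ne y_i$ for all $i$, $x_i\to y$, $y_i\to y$, such that the lines $\mathbb R(x_i-y_i)$ converge to a line $\ell$ and the tangent spaces $T_{x_i}X$ converge to a subspace $T$, one has $\ell\subset T$. A stratification $\mathcal M$ of $M\subset\mathbb R^n$ is a locally finite partition of $M$ into (non-empty) submanifolds, called strata; it is a Whitney stratification if each stratum is Whitney regular over every other stratum. $M^0$ denotes the union of the $0$-dimensional strata of $\mathcal M$. A coordinate plane is a set $\{x\in\mathbb R^n: x_i=0 \text{ for all } i\in I\}$ with $I\subset\{1,\dots,n\}$. A submanifold $S$ is monotonic if its projection on every coordinate plane is a map of constant rank on $S$; a stratification is monotonic if all its strata are. **Lemma 1.5.** Let $M\subset\mathbb R^n$ be a compact set with a monotonic Whitney stratification $\mathcal M$ whose strata are connected, and let $\pi:\mathbb R^n\to\mathbb R$ be the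 projection on a coordinate axis, $\pi(x)=x_k$. Let $\mathcal M'$ be a subset of $\mathcal M$, and let $M'$ be the union of the strata in $\mathcal M'$. Then there exist a set $\mathcal T$ of $1$-dimensional strata of $\mathcal M$ and a set $\mathcal P$ of $0$-dimensional strata of $\mathcal M$ such that: 1. for each $S\in\mathcal T$, the restriction $\pi|_S$ has rank $1$ (at every point of $S$); 2. for each $S\in\mathcal T$, the boundary of $\pi(S)$ in $\mathbb R$ is contained in $\pi(M^0)$; 3. the sets $\pi\big(\bigcup_{S\in\mathcal T}S\big)$ and $\pi\big(\bigcup_{S\in\mathcal P}S\big)$ are disjoint, and their union is equal to $\pi(M')$. -/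

import Mathlib

open Set Filter Topology
open scoped ContDiff

namespace MonotonicStratification

/-- `S` is an embedded smooth (`C^∞`) submanifold of `ℝⁿ`, all of whose components have
dimension `d`: near each of its points a smooth change of coordinates of `ℝⁿ` takes `S` to the
linear subspace on which all coordinates except the first `d` vanish. -/
def IsSubmanifold {n : ℕ} (d : ℕ) (S : Set (EuclideanSpace ℝ (Fin n))) : Prop :=
  d ≤ n ∧ ∀ p ∈ S,
    ∃ φ : OpenPartialHomeomorph (EuclideanSpace ℝ (Fin n)) (EuclideanSpace ℝ (Fin n)),
      p ∈ φ.source ∧ ContDiffOn ℝ ∞ φ φ.source ∧ ContDiffOn ℝ ∞ φ.symm φ.target ∧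
      ∀ x ∈ φ.source, (x ∈ S ↔ ∀ j : Fin n, d ≤ (j : ℕ) → φ x j = 0)

/-- The tangent space `T_p S`, as a linear subspace of `ℝⁿ`: it is spanned by (and, for a
submanifold `S`, consists of) the velocities at `p` of smooth curves in `S` through `p`. -/
def tangentSpace {n : ℕ} (S : Set (EuclideanSpace ℝ (Fin n))) (p : EuclideanSpace ℝ (Fin n)) :
    Submodule ℝ (EuclideanSpace ℝ (Fin n)) :=
  Submodule.span ℝ {v | ∃ γ : ℝ → EuclideanSpace ℝ (Fin n), ContDiffAt ℝ ∞ γ 0 ∧ γ 0 = p ∧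
    (∀ᶠ t in 𝓝 (0 : ℝ), γ t ∈ S) ∧ deriv γ 0 = v}

/-- Convergence of linear subspaces of `ℝⁿ` (in the Grassmannian): the orthogonal projections
onto them converge. -/
def TendstoSubspace {n : ℕ} (V : ℕ → Submodule ℝ (EuclideanSpace ℝ (Fin n)))
    (W : Submodule ℝ (EuclideanSpace ℝ (Fin n))) : Prop :=
  Tendsto (fun i => (V i).starProjection) atTop (𝓝 W.starProjection)

/-- `X` is Whitney regular over `Y` at the point `y`. -/
def WhitneyRegularAt {n : ℕ} (X Y : Set (EuclideanSpace ℝ (Fin n)))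
    (y : EuclideanSpace ℝ (Fin n)) : Prop :=
  ∀ (a b : ℕ → EuclideanSpace ℝ (Fin n)) (l T : Submodule ℝ (EuclideanSpace ℝ (Fin n))),
    (∀ i, a i ∈ X) → (∀ i, b i ∈ Y) → (∀ i, a i ≠ b i) →
    Tendsto a atTop (𝓝 y) → Tendsto b atTop (𝓝 y) →
    TendstoSubspace (fun i => Submodule.span ℝ {a i - b i}) l →
    TendstoSubspace (fun i => tangentSpace X (a i)) T →
    l ≤ T

/-- `X` is Whitney regular over `Y`. -/
def WhitneyRegular {n : ℕ} (X Y : Set (EuclideanSpace ℝ (Fin n))) : Prop :=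
  ∀ y ∈ Y, WhitneyRegularAt X Y y

/-- `𝓜` is a stratification of `M`: a locally finite partition of `M` into submanifolds. -/
structure IsStratification {n : ℕ} (𝓜 : Set (Set (EuclideanSpace ℝ (Fin n))))
    (M : Set (EuclideanSpace ℝ (Fin n))) : Prop where
  nonempty : ∀ S ∈ 𝓜, S.Nonempty
  pairwiseDisjoint : ∀ S ∈ 𝓜, ∀ S' ∈ 𝓜, S ≠ S' → Disjoint S S'
  sUnion_eq : ⋃₀ 𝓜 = M
  locallyFinite : ∀ x ∈ M, ∃ U ∈ 𝓝 x, {S | S ∈ 𝓜 ∧ (S ∩ U).Nonempty}.Finite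
  isSubmanifold : ∀ S ∈ 𝓜, ∃ d, IsSubmanifold d S

/-- A Whitney stratification: each stratum is Whitney regular over any other stratum. -/
structure IsWhitneyStratification {n : ℕ} (𝓜 : Set (Set (EuclideanSpace ℝ (Fin n))))
    (M : Set (EuclideanSpace ℝ (Fin n))) : Prop extends IsStratification 𝓜 M where
  whitneyRegular : ∀ X ∈ 𝓜, ∀ Y ∈ 𝓜, X ≠ Y → WhitneyRegular X Y

/-- The rank at `p ∈ S` of the restriction to the submanifold `S` of a linear map `L`, i.e. the
dimension of the image of `T_p S` under `L`. -/
noncomputable def rankAt {n : ℕ} {F : Type*} [AddCommGroup F] [Module ℝ F]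
    (L : EuclideanSpace ℝ (Fin n) →ₗ[ℝ] F) (S : Set (EuclideanSpace ℝ (Fin n)))
    (p : EuclideanSpace ℝ (Fin n)) : ℕ :=
  Module.finrank ℝ ((tangentSpace S p).map L)

/-- The coordinate plane in `ℝⁿ` given by the equations `x_i = 0`, `i ∈ I`. -/
def coordinatePlane {n : ℕ} (I : Finset (Fin n)) : Submodule ℝ (EuclideanSpace ℝ (Fin n)) where
  carrier := {x | ∀ i ∈ I, x i = 0}
  add_mem' := by
    intro x y hx hy i hi
    simp [hx i hi, hy i hi]
  zero_mem' := by
    intro i _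
    simp
  smul_mem' := by
    intro c x hx i hi
    simp [hx i hi]

/-- The projection of `ℝⁿ` on the coordinate plane `x_i = 0`, `i ∈ I`: the coordinates with
index in `I` are replaced by `0`, the others are kept. -/
def coordinateProjection {n : ℕ} (I : Finset (Fin n)) :
    EuclideanSpace ℝ (Fin n) →ₗ[ℝ] coordinatePlane I where
  toFun x := ⟨WithLp.toLp 2 (fun i => if i ∈ I then 0 else x i), by
    intro i hi
    simp [hi]⟩
  map_add' := by
    intro x y
    ext i
    by_cases hi : i ∈ I <;> simp [hi]
  map_smul' := by
    intro c x
    ext i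
    by_cases hi : i ∈ I <;> simp [hi]

/-- `S` is monotonic: its projection on any coordinate plane is a map of constant rank. -/
def IsMonotonic {n : ℕ} (S : Set (EuclideanSpace ℝ (Fin n))) : Prop :=
  ∀ I : Finset (Fin n), ∃ r : ℕ, ∀ p ∈ S, rankAt (coordinateProjection I) S p = r

/-- The set `𝓜^q` of strata of dimension at most `q`. -/
def strataOfDimLE {n : ℕ} (𝓜 : Set (Set (EuclideanSpace ℝ (Fin n)))) (q : ℕ) :
    Set (Set (EuclideanSpace ℝ (Fin n))) :=
  {S | S ∈ 𝓜 ∧ ∃ d ≤ q, IsSubmanifold d S}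

/-- The union `M^q` of the strata of dimension at most `q`. -/
def skeleton {n : ℕ} (𝓜 : Set (Set (EuclideanSpace ℝ (Fin n)))) (q : ℕ) :
    Set (EuclideanSpace ℝ (Fin n)) :=
  ⋃₀ strataOfDimLE 𝓜 q

end MonotonicStratification

/-! A constant-rank coordinate has no critical point on a stratum unless it is constant there, so
extrema over the compact closure of a stratum are forced onto strata of lower dimension. Suppose
`x_k = c` occurs on a stratum `Y` but on no point stratum. Then `x_k` has rank one on `Y`: were it
constant, maximizing another coordinate over `closure Y` would repeatedly lower the dimension and
end at a point stratum of value `c` (`mem_skeleton_of_extreme`). If `dim Y ≥ 2`, choose `j` so that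
`(x_k, x_j)` has rank two on `Y`, and maximize `x_j` on `closure Y ∩ {x_k = c}`. By Lagrange
multipliers the maximizer is off `Y`, and induction gives a curve stratum `S ⊆ closure Y` through
the level `c` with `x_k` of rank one (`exists_one_dim_stratum`). Finally `π(S) ⊆ π(Y)`: a value of
`S` missed by the interval `π(Y)` would be extreme on `closure Y`, producing a critical point on `S`
(`image_coord_subset_of_subset_closure`).

The descent requires the strata meeting `closure Y` to lie in it and to have smaller dimension off
`Y`. The dimension drop and the frontier condition come from Whitney regularity: near `y ∈ Y`, the
retraction coordinate `g` and the squared distance to the retraction form a submersion on every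
other stratum (`eventually_transverse`). A penalized minimization over `closure X` replaces the
integration of vector fields. -/

namespace MonotonicStratification

/-! ### Adapted charts, retractions and tangent spaces. -/

/-- Local coordinates adapted to `Y` at `y`: `g` is the `V`-component of a chart straightening `Y`
to `V`, and `s` is the inverse chart, so that `s ∘ g` is a local retraction onto `Y`. -/
structure AdaptedChart {n : ℕ} (Y : Set (EuclideanSpace ℝ (Fin n))) (y : EuclideanSpace ℝ (Fin n))
    (V : Submodule ℝ (EuclideanSpace ℝ (Fin n))) where
  g : EuclideanSpace ℝ (Fin n) → EuclideanSpace ℝ (Fin n)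
  s : EuclideanSpace ℝ (Fin n) → EuclideanSpace ℝ (Fin n)
  W : Set (EuclideanSpace ℝ (Fin n))
  isOpen_W : IsOpen W
  mem_W : y ∈ W
  g_mem : ∀ x, g x ∈ V
  contDiffAt_g : ∀ x ∈ W, ContDiffAt ℝ ∞ g x
  contDiffAt_s : ∀ x ∈ W, ContDiffAt ℝ ∞ s (g x)
  retr_mem : ∀ x ∈ W, s (g x) ∈ Y
  retr_eq : ∀ x ∈ W, x ∈ Y → s (g x) = x
  eventually_s : ∀ᶠ c in 𝓝 (g y), c ∈ V → s c ∈ Y ∧ g (s c) = c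

lemma finrank_coordinatePlane_ge {n d : ℕ} (hd : d ≤ n) :
    Module.finrank ℝ (coordinatePlane (n := n) (Finset.univ.filter fun j => d ≤ (j : ℕ))) = d := by
  let f : coordinatePlane (n := n) (Finset.univ.filter fun j => d ≤ (j : ℕ)) ≃ₗ[ℝ] (Fin d → ℝ) :=
    { toFun := fun x i => x.1 (Fin.castLE hd i)
      map_add' := fun x y => by ext i; simp
      map_smul' := fun c x => by ext i; simp
      invFun := fun u => ⟨WithLp.toLp 2 fun j => if h : (j : ℕ) < d then u ⟨j, h⟩ else 0, by
        intro i hi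
        simp only [Finset.mem_filter, Finset.mem_univ, true_and] at hi
        simp [not_lt.2 hi]⟩
      left_inv := fun x => by
        ext j
        by_cases h : (j : ℕ) < d
        · simp [h]
        · have := x.2 j (by simpa using h)
          simp [h, this]
      right_inv := fun u => by ext i; simp }
  simpa using f.finrank_eq

lemma IsSubmanifold.exists_adaptedChart {n d : ℕ} {Y : Set (EuclideanSpace ℝ (Fin n))}
    (hY : IsSubmanifold d Y) {y : EuclideanSpace ℝ (Fin n)} (hy : y ∈ Y) :
    ∃ V : Submodule ℝ (EuclideanSpace ℝ (Fin n)), Module.finrank ℝ V = d ∧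
      Nonempty (AdaptedChart Y y V) := by
  obtain ⟨hdn, h⟩ := hY
  obtain ⟨φ, hyφ, hφ, hφs, hφY⟩ := h y hy
  set V := coordinatePlane (n := n) (Finset.univ.filter fun j => d ≤ (j : ℕ)) with hV
  have hmem : ∀ x ∈ φ.source, (x ∈ Y ↔ φ x ∈ V) := by
    intro x hx
    rw [hφY x hx]
    change _ ↔ ∀ i ∈ (Finset.univ.filter fun j : Fin n => d ≤ (j : ℕ)), φ x i = 0
    simp
  have hproj : ∀ x ∈ φ.source, x ∈ Y → V.starProjection (φ x) = φ x := fun x hx hxY =>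
    Submodule.starProjection_eq_self_iff.2 ((hmem x hx).1 hxY)
  have hpm : ∀ u, V.starProjection u ∈ V := fun u => Submodule.starProjection_apply_mem V u
  -- Projecting `φ x` to `V` may leave the target of the chart; such points are discarded so that `s
  -- ∘ g` makes sense on `W`.
  let W : Set (EuclideanSpace ℝ (Fin n)) :=
    φ.source ∩ φ ⁻¹' (V.starProjection ⁻¹' φ.target)
  have hW : IsOpen W :=
    φ.continuousOn.isOpen_inter_preimage φ.open_source
      (φ.open_target.preimage V.starProjection.continuous)
  refine ⟨V, finrank_coordinatePlane_ge hdn, ⟨?_⟩⟩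
  refine
    { g := fun x => V.starProjection (φ x)
      s := φ.symm
      W := W
      isOpen_W := hW
      mem_W := ⟨hyφ, by
        change V.starProjection (φ y) ∈ φ.target
        rw [hproj y hyφ hy]; exact φ.map_source hyφ⟩
      g_mem := fun x => hpm (φ x)
      contDiffAt_g := fun x hx => V.starProjection.contDiff.contDiffAt.comp x
        (hφ.contDiffAt (φ.open_source.mem_nhds hx.1))
      contDiffAt_s := fun x hx =>
        hφs.contDiffAt (x := V.starProjection (φ x)) (φ.open_target.mem_nhds hx.2)
      retr_mem := fun x hx => by
        rw [hmem _ (φ.map_target hx.2), φ.right_inv hx.2]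
        exact hpm _
      retr_eq := fun x hx hxY => by
        rw [hproj x hx.1 hxY, φ.left_inv hx.1]
      eventually_s := ?_ }
  have : φ.target ∈ 𝓝 (V.starProjection (φ y)) := by
    rw [hproj y hyφ hy]; exact φ.open_target.mem_nhds (φ.map_source hyφ)
  filter_upwards [this] with c hc hcV
  refine ⟨?_, ?_⟩
  · rw [hmem _ (φ.map_target hc), φ.right_inv hc]; exact hcV
  · rw [φ.right_inv hc]; exact Submodule.starProjection_eq_self_iff.2 hcV

namespace AdaptedChart

variable {n : ℕ} {Y : Set (EuclideanSpace ℝ (Fin n))} {y : EuclideanSpace ℝ (Fin n)}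
  {V : Submodule ℝ (EuclideanSpace ℝ (Fin n))}

/-- The local retraction onto `Y`. -/
def r (A : AdaptedChart Y y V) (x : EuclideanSpace ℝ (Fin n)) : EuclideanSpace ℝ (Fin n) :=
  A.s (A.g x)

variable (A : AdaptedChart Y y V)

lemma contDiffAt_r {x : EuclideanSpace ℝ (Fin n)} (hx : x ∈ A.W) : ContDiffAt ℝ ∞ A.r x :=
  (A.contDiffAt_s x hx).comp x (A.contDiffAt_g x hx)

lemma hasFDerivAt_g {x : EuclideanSpace ℝ (Fin n)} (hx : x ∈ A.W) :
    HasFDerivAt A.g (fderiv ℝ A.g x) x :=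
  ((A.contDiffAt_g x hx).differentiableAt (by simp)).hasFDerivAt

lemma hasFDerivAt_r {x : EuclideanSpace ℝ (Fin n)} (hx : x ∈ A.W) :
    HasFDerivAt A.r (fderiv ℝ A.r x) x :=
  ((A.contDiffAt_r hx).differentiableAt (by simp)).hasFDerivAt

lemma hasFDerivAt_s : HasFDerivAt A.s (fderiv ℝ A.s (A.g y)) (A.g y) :=
  ((A.contDiffAt_s y A.mem_W).differentiableAt (by simp)).hasFDerivAt

lemma fderiv_r : fderiv ℝ A.r y = (fderiv ℝ A.s (A.g y)).comp (fderiv ℝ A.g y) :=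
  (A.hasFDerivAt_s.comp y (A.hasFDerivAt_g A.mem_W)).fderiv

lemma W_mem_nhds : A.W ∈ 𝓝 y := A.isOpen_W.mem_nhds A.mem_W

lemma tendsto_fderiv_g :
    Tendsto (fderiv ℝ A.g) (𝓝 y) (𝓝 (fderiv ℝ A.g y)) :=
  ((A.contDiffAt_g y A.mem_W).fderiv_right (m := 0) (by simp)).continuousAt

lemma tendsto_fderiv_r :
    Tendsto (fderiv ℝ A.r) (𝓝 y) (𝓝 (fderiv ℝ A.r y)) :=
  ((A.contDiffAt_r A.mem_W).fderiv_right (m := 0) (by simp)).continuousAt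

lemma r_eq_self {x : EuclideanSpace ℝ (Fin n)} (hx : x ∈ A.W) (hxY : x ∈ Y) : A.r x = x :=
  A.retr_eq x hx hxY

lemma r_mem {x : EuclideanSpace ℝ (Fin n)} (hx : x ∈ A.W) : A.r x ∈ Y := A.retr_mem x hx

lemma fderiv_g_mem (v : EuclideanSpace ℝ (Fin n)) : fderiv ℝ A.g y v ∈ V := by
  have h1 := V.starProjection.hasFDerivAt.comp y (A.hasFDerivAt_g A.mem_W)
  have h2 : (V.starProjection ∘ A.g) = A.g := by
    funext x
    exact Submodule.starProjection_eq_self_iff.2 (A.g_mem x)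
  rw [h2] at h1
  have h3 := h1.unique (A.hasFDerivAt_g A.mem_W)
  rw [← h3]
  exact Submodule.starProjection_apply_mem V _

/-- The retraction fixes every curve in `Y` near `y`, hence fixes its velocity; linearity extends
this to the span. -/
lemma fderiv_r_eq_self {v : EuclideanSpace ℝ (Fin n)} (hv : v ∈ tangentSpace Y y) :
    fderiv ℝ A.r y v = v := by
  have hle : tangentSpace Y y ≤
      LinearMap.eqLocus (fderiv ℝ A.r y).toLinearMap LinearMap.id := by
    refine Submodule.span_le.2 ?_
    rintro v ⟨γ, hγ, h0, hγY, rfl⟩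
    have hd : HasDerivAt γ (deriv γ 0) 0 := (hγ.differentiableAt (by simp)).hasDerivAt
    have h1 : HasDerivAt (A.r ∘ γ) (fderiv ℝ A.r y (deriv γ 0)) 0 := by
      have : HasFDerivAt A.r (fderiv ℝ A.r y) (γ 0) := by
        simpa [h0] using A.hasFDerivAt_r A.mem_W
      exact this.comp_hasDerivAt 0 hd
    have h2 : A.r ∘ γ =ᶠ[𝓝 0] γ := by
      have hW : ∀ᶠ t in 𝓝 (0 : ℝ), γ t ∈ A.W := by
        apply hγ.continuousAt
        rw [h0]; exact A.W_mem_nhds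
      filter_upwards [hW, hγY] with t h3 h4 using A.r_eq_self h3 h4
    exact (h1.congr_of_eventuallyEq h2.symm).unique hd
  exact hle hv

lemma s_g (hy : y ∈ Y) : A.s (A.g y) = y := A.retr_eq y A.mem_W hy

lemma fderiv_s_mem (hy : y ∈ Y) {a : EuclideanSpace ℝ (Fin n)} (ha : a ∈ V) :
    fderiv ℝ A.s (A.g y) a ∈ tangentSpace Y y := by
  have hline : ContDiff ℝ ∞ fun t : ℝ => A.g y + t • a := by fun_prop
  have hs : ContDiffAt ℝ ∞ A.s ((fun t : ℝ => A.g y + t • a) 0) := by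
    simpa using A.contDiffAt_s y A.mem_W
  refine Submodule.subset_span ⟨fun t => A.s (A.g y + t • a), ?_, ?_, ?_, ?_⟩
  · exact hs.comp (0 : ℝ) hline.contDiffAt
  · simp [A.s_g hy]
  · have ht : Tendsto (fun t : ℝ => A.g y + t • a) (𝓝 0) (𝓝 (A.g y)) := by
      simpa using hline.continuous.tendsto 0
    filter_upwards [ht.eventually A.eventually_s] with t h
    exact (h (V.add_mem (A.g_mem y) (V.smul_mem _ ha))).1
  · have hl : HasDerivAt (fun t : ℝ => A.g y + t • a) a 0 := by
      simpa using ((hasDerivAt_id (0 : ℝ)).smul_const a).const_add (A.g y)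
    have h := A.hasFDerivAt_s
    have h' : HasFDerivAt A.s (fderiv ℝ A.s (A.g y)) ((fun t : ℝ => A.g y + t • a) 0) := by
      simpa using h
    exact (h'.comp_hasDerivAt 0 hl).deriv

lemma fderiv_g_fderiv_s (hy : y ∈ Y) {a : EuclideanSpace ℝ (Fin n)} (ha : a ∈ V) :
    fderiv ℝ A.g y (fderiv ℝ A.s (A.g y) a) = a := by
  have hl : HasDerivAt (fun t : ℝ => A.g y + t • a) a 0 := by
    simpa using ((hasDerivAt_id (0 : ℝ)).smul_const a).const_add (A.g y)
  have h : HasFDerivAt A.s (fderiv ℝ A.s (A.g y)) ((fun t : ℝ => A.g y + t • a) 0) := by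
    simpa using A.hasFDerivAt_s
  have h1 := h.comp_hasDerivAt 0 hl
  have h2 : HasFDerivAt A.g (fderiv ℝ A.g y) ((A.s ∘ fun t : ℝ => A.g y + t • a) 0) := by
    simpa [A.s_g hy] using A.hasFDerivAt_g A.mem_W
  have h3 := h2.comp_hasDerivAt 0 h1
  have ht : Tendsto (fun t : ℝ => A.g y + t • a) (𝓝 0) (𝓝 (A.g y)) := by
    simpa using hl.continuousAt.tendsto
  have h4 : A.g ∘ (A.s ∘ fun t : ℝ => A.g y + t • a) =ᶠ[𝓝 0] fun t : ℝ => A.g y + t • a := by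
    filter_upwards [ht.eventually A.eventually_s] with t h
    exact (h (V.add_mem (A.g_mem y) (V.smul_mem _ ha))).2
  exact (h3.congr_of_eventuallyEq h4.symm).unique hl

/-- The derivatives of `g` and `s` restrict to inverse maps between the tangent space and `V`, so
the span of velocities has the expected dimension. -/
lemma finrank_tangentSpace (A : AdaptedChart Y y V) (hy : y ∈ Y) :
    Module.finrank ℝ (tangentSpace Y y) = Module.finrank ℝ V := by
  apply le_antisymm
  · let f : tangentSpace Y y →ₗ[ℝ] V :=
      ((fderiv ℝ A.g y).toLinearMap.comp (tangentSpace Y y).subtype).codRestrict V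
        (fun v => A.fderiv_g_mem v)
    apply LinearMap.finrank_le_finrank_of_injective (f := f)
    intro v w hvw
    have h1 : fderiv ℝ A.g y v = fderiv ℝ A.g y w := congrArg Subtype.val hvw
    ext1
    rw [← A.fderiv_r_eq_self v.2, ← A.fderiv_r_eq_self w.2, A.fderiv_r]
    simp [h1]
  · let f : V →ₗ[ℝ] tangentSpace Y y :=
      ((fderiv ℝ A.s (A.g y)).toLinearMap.comp V.subtype).codRestrict (tangentSpace Y y)
        (fun v => A.fderiv_s_mem hy v.2)
    apply LinearMap.finrank_le_finrank_of_injective (f := f)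
    intro v w hvw
    have h1 : fderiv ℝ A.s (A.g y) v = fderiv ℝ A.s (A.g y) w := congrArg Subtype.val hvw
    ext1
    rw [← A.fderiv_g_fderiv_s hy v.2, ← A.fderiv_g_fderiv_s hy w.2, h1]

end AdaptedChart

lemma IsSubmanifold.finrank_tangentSpace {n d : ℕ} {Y : Set (EuclideanSpace ℝ (Fin n))}
    (hY : IsSubmanifold d Y) {y : EuclideanSpace ℝ (Fin n)} (hy : y ∈ Y) :
    Module.finrank ℝ (tangentSpace Y y) = d := by
  obtain ⟨V, hV, ⟨A⟩⟩ := hY.exists_adaptedChart hy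
  rw [A.finrank_tangentSpace hy, hV]

lemma IsLocalExtrOn.eq_zero_of_mem_tangentSpace {n : ℕ} {Z : Set (EuclideanSpace ℝ (Fin n))}
    {z : EuclideanSpace ℝ (Fin n)} {F : EuclideanSpace ℝ (Fin n) → ℝ}
    {F' : EuclideanSpace ℝ (Fin n) →L[ℝ] ℝ} (h : IsLocalExtrOn F Z z) (hF : HasFDerivAt F F' z)
    {v : EuclideanSpace ℝ (Fin n)} (hv : v ∈ tangentSpace Z z) : F' v = 0 := by
  have hle : tangentSpace Z z ≤ LinearMap.ker F'.toLinearMap := by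
    refine Submodule.span_le.2 ?_
    rintro v ⟨γ, hγ, h0, hγZ, rfl⟩
    subst h0
    have hd : HasDerivAt γ (deriv γ 0) 0 := (hγ.differentiableAt (by simp)).hasDerivAt
    have h1 := hF.comp_hasDerivAt 0 hd
    have ht : Tendsto γ (𝓝 0) (𝓝[Z] (γ 0)) :=
      tendsto_nhdsWithin_iff.2 ⟨hγ.continuousAt, hγZ⟩
    have h2 : IsLocalExtr (F ∘ γ) 0 := by
      rcases h with h | h
      · exact Or.inl (ht.eventually h)
      · exact Or.inr (ht.eventually h)
    exact h2.hasDerivAt_eq_zero h1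
  exact hle hv

end MonotonicStratification

/-! ### Limits of subspaces, Whitney regularity and transversality. -/

namespace MonotonicStratification

lemma tendstoSubspace_span_singleton {n : ℕ} {u : ℕ → EuclideanSpace ℝ (Fin n)}
    {v : EuclideanSpace ℝ (Fin n)} (hv : v ≠ 0) (hu : Tendsto u atTop (𝓝 v)) :
    TendstoSubspace (fun i => Submodule.span ℝ {u i}) (Submodule.span ℝ {v}) := by
  have hc : ContinuousOn (fun w : EuclideanSpace ℝ (Fin n) =>
      (Submodule.span ℝ {w}).starProjection) {w | w ≠ 0} := by
    rw [continuousOn_clm_apply]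
    intro z
    simp_rw [Submodule.starProjection_singleton]
    have h1 : ContinuousOn (fun w : EuclideanSpace ℝ (Fin n) => inner ℝ w z) {w | w ≠ 0} := by
      fun_prop
    have h2 : ContinuousOn (fun w : EuclideanSpace ℝ (Fin n) => ((‖w‖ ^ 2 : ℝ) : ℝ))
        {w | w ≠ 0} := by fun_prop
    refine ContinuousOn.smul (ContinuousOn.div h1 h2 ?_) continuousOn_id
    intro w hw
    have : ‖w‖ ≠ 0 := norm_ne_zero_iff.2 hw
    exact_mod_cast pow_ne_zero 2 this
  exact (hc.continuousAt (isOpen_ne.mem_nhds hv)).tendsto.comp hu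

/-- Idempotence and self-adjointness are closed conditions. This lets compactness of a ball of
operators yield limiting tangent spaces. -/
lemma exists_tendsto_starProjection {n : ℕ} {V : ℕ → Submodule ℝ (EuclideanSpace ℝ (Fin n))}
    {P : EuclideanSpace ℝ (Fin n) →L[ℝ] EuclideanSpace ℝ (Fin n)}
    (h : Tendsto (fun i => (V i).starProjection) atTop (𝓝 P)) :
    ∃ T, TendstoSubspace V T ∧ P = T.starProjection := by
  have hclosed : IsClosed {p : EuclideanSpace ℝ (Fin n) →L[ℝ] EuclideanSpace ℝ (Fin n) |
      p * p = p ∧ star p = p} :=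
    (isClosed_eq (by fun_prop) continuous_id).inter (isClosed_eq ContinuousLinearMap.adjoint.continuous continuous_id)
  have hP : P * P = P ∧ star P = P := hclosed.mem_of_tendsto h <| Eventually.of_forall fun i => by
    have : IsStarProjection (V i).starProjection := isStarProjection_starProjection
    exact ⟨this.isIdempotentElem, this.isSelfAdjoint⟩
  have hP' : IsStarProjection P := ⟨hP.1, hP.2⟩
  obtain ⟨T, hT, rfl⟩ := isStarProjection_iff_eq_starProjection.1 hP'
  exact ⟨T, h, rfl⟩

lemma span_singleton_inv_smul {E : Type*} [AddCommGroup E] [Module ℝ E] {t : ℝ} (ht : t ≠ 0)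
    (u : E) : Submodule.span ℝ {t⁻¹ • u} = Submodule.span ℝ {u} :=
  Submodule.span_singleton_smul_eq (IsUnit.mk0 _ (inv_ne_zero ht)) u

/-- Whitney's condition (b) implies condition (a). -/
lemma WhitneyRegularAt.tangentSpace_le {n : ℕ} {X Y : Set (EuclideanSpace ℝ (Fin n))}
    {y : EuclideanSpace ℝ (Fin n)} (h : WhitneyRegularAt X Y y) (hXY : Disjoint X Y)
    {x : ℕ → EuclideanSpace ℝ (Fin n)} (hx : ∀ i, x i ∈ X) (hxy : Tendsto x atTop (𝓝 y))
    {T : Submodule ℝ (EuclideanSpace ℝ (Fin n))}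
    (hT : TendstoSubspace (fun i => tangentSpace X (x i)) T) : tangentSpace Y y ≤ T := by
  refine Submodule.span_le.2 ?_
  rintro v ⟨γ, hγ, rfl, hγY, rfl⟩
  by_cases hv : deriv γ 0 = 0
  · rw [hv]; exact T.zero_mem
  have hne : ∀ i, x i ≠ γ 0 := fun i hi =>
    hXY.ne_of_mem (hx i) hγY.self_of_nhds hi
  -- The square root makes `x i - γ 0` negligible compared with `t i`, so the secants from `γ (t i)`
  -- to `x i` approach the tangent line of `γ`.
  set t : ℕ → ℝ := fun i => Real.sqrt ‖x i - γ 0‖ with ht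
  have htpos : ∀ i, 0 < t i := fun i =>
    Real.sqrt_pos.2 (norm_pos_iff.2 (sub_ne_zero.2 (hne i)))
  have ht0 : Tendsto t atTop (𝓝 0) := by
    have h1 : Tendsto (fun i => ‖x i - γ 0‖) atTop (𝓝 0) :=
      tendsto_iff_norm_sub_tendsto_zero.1 hxy
    simpa [Function.comp_def] using (Real.continuous_sqrt.tendsto 0).comp h1
  have ht0' : Tendsto t atTop (𝓝[≠] 0) :=
    tendsto_nhdsWithin_iff.2 ⟨ht0, Eventually.of_forall fun i => (htpos i).ne'⟩
  have hd : HasDerivAt γ (deriv γ 0) 0 := (hγ.differentiableAt (by simp)).hasDerivAt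
  have hslope : Tendsto (fun i => (t i)⁻¹ • (γ (t i) - γ 0)) atTop (𝓝 (deriv γ 0)) := by
    have := (hasDerivAt_iff_tendsto_slope_zero.1 hd).comp ht0'
    simpa [Function.comp_def] using this
  have hsmall : Tendsto (fun i => (t i)⁻¹ • (x i - γ 0)) atTop (𝓝 0) := by
    rw [tendsto_zero_iff_norm_tendsto_zero]
    refine ht0.congr fun i => ?_
    have h2 : ‖x i - γ 0‖ = t i * t i := (Real.mul_self_sqrt (norm_nonneg _)).symm
    have := htpos i
    rw [norm_smul, h2, norm_inv, Real.norm_of_nonneg this.le]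
    field_simp
  have hu : Tendsto (fun i => (t i)⁻¹ • (x i - γ (t i))) atTop (𝓝 (-deriv γ 0)) := by
    have := hsmall.sub hslope
    simp only [zero_sub] at this
    refine this.congr fun i => ?_
    rw [← smul_sub]; congr 1; abel
  have hline := tendstoSubspace_span_singleton (neg_ne_zero.2 hv) hu
  obtain ⟨N, hN⟩ := eventually_atTop.1 (ht0.eventually hγY)
  have hle := h (fun i => x (i + N)) (fun i => γ (t (i + N)))
    (Submodule.span ℝ {-deriv γ 0}) T (fun i => hx _) (fun i => hN _ (by omega))
    (fun i => hXY.ne_of_mem (hx _) (hN _ (by omega)))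
    ((tendsto_add_atTop_iff_nat N).2 hxy)
    ((hγ.continuousAt.tendsto.comp ht0).comp (tendsto_add_atTop_nat N))
    (by
      have h3 := hline.comp (tendsto_add_atTop_nat N)
      refine h3.congr fun i => ?_
      simp only [Function.comp_apply, span_singleton_inv_smul (htpos _).ne'])
    (hT.comp (tendsto_add_atTop_nat N))
  have h4 := hle (Submodule.mem_span_singleton_self _)
  simpa using h4

namespace AdaptedChart

variable {n : ℕ} {Y : Set (EuclideanSpace ℝ (Fin n))} {y : EuclideanSpace ℝ (Fin n)}
  {V : Submodule ℝ (EuclideanSpace ℝ (Fin n))} (A : AdaptedChart Y y V)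

lemma tendsto_r (hy : y ∈ Y) : Tendsto A.r (𝓝 y) (𝓝 y) := by
  have := (A.contDiffAt_r A.mem_W).continuousAt.tendsto
  rwa [A.r_eq_self A.mem_W hy] at this

/-- Since `r (r x) = r x`, strict differentiability of `r` at `y` between `x` and `r x` makes the
derivative of `r` on `x - r x` of order `o(‖x - r x‖)`. -/
lemma tendsto_fderiv_r_secant (hy : y ∈ Y) {x : ℕ → EuclideanSpace ℝ (Fin n)}
    (hx : Tendsto x atTop (𝓝 y)) :
    Tendsto (fun i => fderiv ℝ A.r y (‖x i - A.r (x i)‖⁻¹ • (x i - A.r (x i)))) atTop (𝓝 0) := by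
  have hrx := (A.tendsto_r hy).comp hx
  have hs : HasStrictFDerivAt A.r (fderiv ℝ A.r y) y :=
    (A.contDiffAt_r A.mem_W).hasStrictFDerivAt (by simp)
  have h1 := hs.isLittleO.comp_tendsto (hx.prodMk_nhds hrx)
  have h2 := (h1.norm_right.tendsto_inv_smul_nhds_zero).neg
  rw [neg_zero] at h2
  refine h2.congr' ?_
  filter_upwards [hx.eventually A.W_mem_nhds, hrx.eventually A.W_mem_nhds] with i hi hri
  have h3 : A.r (A.r (x i)) = A.r (x i) := A.r_eq_self hri (A.r_mem hi)
  simp [h3, ← smul_neg]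

/-- Whitney regularity of `Z` over `Y` implies that `(g, ‖· - r‖²)` restricts to a submersion
on `Z` near `y`. -/
lemma eventually_transverse (hy : y ∈ Y) {Z : Set (EuclideanSpace ℝ (Fin n))}
    (h : WhitneyRegularAt Z Y y) (hZY : Disjoint Z Y) :
    ∀ᶠ x in 𝓝 y, x ∈ Z → ∀ a ∈ V, ∀ β : ℝ,
      (∀ v ∈ tangentSpace Z x, inner ℝ a (fderiv ℝ A.g x v) +
        β * inner ℝ (x - A.r x) (v - fderiv ℝ A.r x v) = 0) → a = 0 ∧ β = 0 := by
  by_contra hcon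
  rw [not_eventually] at hcon
  obtain ⟨x, hxy, hx⟩ := exists_seq_forall_of_frequently (hcon.and_eventually A.W_mem_nhds)
  simp only [Classical.not_imp, not_forall] at hx
  choose hx hxW using hx
  choose hxZ a haV β hvan hne using hx
  have hd : ∀ i, x i - A.r (x i) ≠ 0 := fun i =>
    sub_ne_zero.2 (hZY.ne_of_mem (hxZ i) (A.r_mem (hxW i)))
  set δ : ℕ → ℝ := fun i => ‖x i - A.r (x i)‖ with hδ
  have hδ0 : ∀ i, δ i ≠ 0 := fun i => norm_ne_zero_iff.2 (hd i)
  set w : ℕ → EuclideanSpace ℝ (Fin n) := fun i => (δ i)⁻¹ • (x i - A.r (x i)) with hw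
  -- Absorbing `δ i` into the multiplier replaces `x - r x` by a unit secant, so the normalized
  -- relations have a nontrivial limit.
  set q : ℕ → EuclideanSpace ℝ (Fin n) × ℝ := fun i => (a i, β i * δ i) with hq
  have hq0 : ∀ i, ‖q i‖ ≠ 0 := by
    intro i hi
    rw [norm_eq_zero, Prod.mk_eq_zero] at hi
    exact hne i ⟨hi.1, (mul_eq_zero.1 hi.2).resolve_right (hδ0 i)⟩
  set q' : ℕ → EuclideanSpace ℝ (Fin n) × ℝ := fun i => ‖q i‖⁻¹ • q i with hq'
  have hvan' : ∀ i, ∀ v ∈ tangentSpace Z (x i), inner ℝ (q' i).1 (fderiv ℝ A.g (x i) v) +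
      (q' i).2 * inner ℝ (w i) (v - fderiv ℝ A.r (x i) v) = 0 := by
    intro i v hv
    have h1 := hvan i v hv
    have h2 := hδ0 i
    have h3 := hq0 i
    simp only [hq', hw, Prod.smul_fst, Prod.smul_snd, inner_smul_left, smul_eq_mul,
      RCLike.conj_to_real]
    simp only [hq] at h3 ⊢
    field_simp
    simpa using h1
  have hKc : IsCompact (Metric.closedBall
      (0 : EuclideanSpace ℝ (Fin n) →L[ℝ] EuclideanSpace ℝ (Fin n)) 1 ×ˢ
      (Metric.sphere (0 : EuclideanSpace ℝ (Fin n)) 1 ×ˢ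
        Metric.sphere (0 : EuclideanSpace ℝ (Fin n) × ℝ) 1)) := by
    have : ProperSpace (EuclideanSpace ℝ (Fin n) →L[ℝ] EuclideanSpace ℝ (Fin n)) :=
      FiniteDimensional.proper ℝ _
    exact (isCompact_closedBall _ _).prod ((isCompact_sphere _ _).prod (isCompact_sphere _ _))
  have hK : ∀ i, ((tangentSpace Z (x i)).starProjection, w i, q' i) ∈ Metric.closedBall
      (0 : EuclideanSpace ℝ (Fin n) →L[ℝ] EuclideanSpace ℝ (Fin n)) 1 ×ˢ
      (Metric.sphere (0 : EuclideanSpace ℝ (Fin n)) 1 ×ˢ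
        Metric.sphere (0 : EuclideanSpace ℝ (Fin n) × ℝ) 1) := by
    intro i
    refine ⟨?_, ?_, ?_⟩
    · simpa using Submodule.starProjection_norm_le _
    · have := hδ0 i
      simp only [mem_sphere_iff_norm, sub_zero, hw, norm_smul, norm_inv]
      rw [Real.norm_of_nonneg (norm_nonneg _)]
      exact inv_mul_cancel₀ this
    · have := hq0 i
      simp only [mem_sphere_iff_norm, sub_zero, hq', norm_smul, norm_inv, norm_norm]
      exact inv_mul_cancel₀ this
  obtain ⟨⟨P, w0, q0⟩, hlim, φ, hφ, htend⟩ := hKc.tendsto_subseq hK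
  have hPt : Tendsto (fun i => (tangentSpace Z (x (φ i))).starProjection) atTop (𝓝 P) :=
    (continuous_fst.tendsto _).comp htend
  have hwt : Tendsto (fun i => w (φ i)) atTop (𝓝 w0) :=
    ((continuous_fst.comp continuous_snd).tendsto _).comp htend
  have hqt : Tendsto (fun i => q' (φ i)) atTop (𝓝 q0) :=
    ((continuous_snd.comp continuous_snd).tendsto _).comp htend
  have hw0 : ‖w0‖ = 1 := by simpa using hlim.2.1
  have hq1 : ‖q0‖ = 1 := by simpa using hlim.2.2
  have hxφ : Tendsto (fun i => x (φ i)) atTop (𝓝 y) := hxy.comp hφ.tendsto_atTop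
  obtain ⟨T, hT, rfl⟩ := exists_tendsto_starProjection hPt
  have hYT : tangentSpace Y y ≤ T := h.tangentSpace_le hZY (fun i => hxZ (φ i)) hxφ hT
  have hw0ne : w0 ≠ 0 := by
    intro h0; simp [h0] at hw0
  have hwT : w0 ∈ T := by
    have hl := tendstoSubspace_span_singleton hw0ne hwt
    refine h (fun i => x (φ i)) (fun i => A.r (x (φ i))) _ T (fun i => hxZ _)
      (fun i => A.r_mem (hxW _)) (fun i => sub_ne_zero.1 (hd _)) hxφ
      ((A.tendsto_r hy).comp hxφ) ?_ hT (Submodule.mem_span_singleton_self w0)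
    refine hl.congr fun i => ?_
    simp only [hw, span_singleton_inv_smul (hδ0 _)]
  have hQw : fderiv ℝ A.r y w0 = 0 :=
    tendsto_nhds_unique (((fderiv ℝ A.r y).continuous.tendsto _).comp hwt)
      (A.tendsto_fderiv_r_secant hy hxφ)
  have hlimvan : ∀ v ∈ T, inner ℝ q0.1 (fderiv ℝ A.g y v) +
      q0.2 * inner ℝ w0 (v - fderiv ℝ A.r y v) = 0 := by
    intro v hv
    have hvi : Tendsto (fun i => (tangentSpace Z (x (φ i))).starProjection v) atTop (𝓝 v) := by
      have h1 : Tendsto (fun i => (tangentSpace Z (x (φ i))).starProjection v) atTop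
          (𝓝 (T.starProjection v)) :=
        ((ContinuousLinearMap.apply ℝ _ v).continuous.tendsto _).comp hT
      rwa [Submodule.starProjection_eq_self_iff.2 hv] at h1
    have hev := isBoundedBilinearMap_apply (𝕜 := ℝ) (E := EuclideanSpace ℝ (Fin n))
      (F := EuclideanSpace ℝ (Fin n)) |>.continuous
    have hg := (hev.tendsto _).comp ((A.tendsto_fderiv_g.comp hxφ).prodMk_nhds hvi)
    have hr := (hev.tendsto _).comp ((A.tendsto_fderiv_r.comp hxφ).prodMk_nhds hvi)
    have h2 := (((continuous_fst.tendsto _).comp hqt).inner hg (𝕜 := ℝ)).add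
      (((continuous_snd.tendsto _).comp hqt).mul (hwt.inner (hvi.sub hr) (𝕜 := ℝ)))
    refine tendsto_nhds_unique h2 (tendsto_const_nhds.congr fun i => ?_)
    exact (hvan' (φ i) _ (Submodule.starProjection_apply_mem _ v)).symm
  have hq0V : q0.1 ∈ V := by
    have hVc : IsClosed (V : Set (EuclideanSpace ℝ (Fin n))) := V.closed_of_finiteDimensional
    refine hVc.mem_of_tendsto ((continuous_fst.tendsto _).comp hqt)
      (Eventually.of_forall fun i => ?_)
    exact V.smul_mem _ (haV _)
  -- Testing on the vector of the tangent space of `Y` corresponding to `q0.1` isolates `‖q0.1‖²`;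
  -- it lies in `T` by condition (a). The limit secant `w0`, in `T` by condition (b), then kills the
  -- other component.
  have ha0 : q0.1 = 0 := by
    have hv := A.fderiv_s_mem hy hq0V
    have h1 := hlimvan _ (hYT hv)
    rw [A.fderiv_g_fderiv_s hy hq0V, A.fderiv_r_eq_self hv, sub_self, inner_zero_right,
      mul_zero, add_zero] at h1
    exact inner_self_eq_zero.1 h1
  have hb0 : q0.2 = 0 := by
    have h1 := hlimvan _ hwT
    rw [hQw, ha0, inner_zero_left, zero_add, sub_zero, real_inner_self_eq_norm_sq, hw0] at h1
    simpa using h1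
  have : q0 = 0 := Prod.ext ha0 hb0
  simp [this] at hq1

/-- Transversality supplies `dim V + 1` independent functionals on the tangent space of `Z`. -/
lemma eventually_finrank_lt (A : AdaptedChart Y y V) (hy : y ∈ Y) {Z : Set (EuclideanSpace ℝ (Fin n))}
    (h : WhitneyRegularAt Z Y y) (hZY : Disjoint Z Y) :
    ∀ᶠ x in 𝓝 y, x ∈ Z → Module.finrank ℝ V < Module.finrank ℝ (tangentSpace Z x) := by
  filter_upwards [A.eventually_transverse hy h hZY] with x hx hxZ
  let f : (V × ℝ) →ₗ[ℝ] Module.Dual ℝ (tangentSpace Z x) :=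
    LinearMap.mk₂ ℝ (fun (p : V × ℝ) (v : tangentSpace Z x) =>
      (inner ℝ (p.1 : EuclideanSpace ℝ (Fin n)) (fderiv ℝ A.g x v) +
        p.2 * inner ℝ (x - A.r x) ((v : EuclideanSpace ℝ (Fin n)) - fderiv ℝ A.r x v) : ℝ))
      (fun p p' v => by simp [inner_add_left]; ring)
      (fun c p v => by simp [inner_smul_left]; ring)
      (fun p v v' => by simp [inner_add_right, inner_sub_right]; ring)
      (fun c p v => by simp [inner_smul_right, inner_sub_right]; ring)
  have hinj : Function.Injective f := by
    rw [injective_iff_map_eq_zero]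
    rintro ⟨a, β⟩ hf
    obtain ⟨h1, h2⟩ := hx hxZ a a.2 β fun v hv => LinearMap.congr_fun hf ⟨v, hv⟩
    exact Prod.ext (Subtype.ext h1) h2
  have := LinearMap.finrank_le_finrank_of_injective hinj
  rw [Subspace.dual_finrank_eq, Module.finrank_prod, Module.finrank_self] at this
  omega

end AdaptedChart

end MonotonicStratification

/-! ### The frontier condition. -/

namespace MonotonicStratification

namespace AdaptedChart

variable {n : ℕ} {Y : Set (EuclideanSpace ℝ (Fin n))} {y : EuclideanSpace ℝ (Fin n)}
  {V : Submodule ℝ (EuclideanSpace ℝ (Fin n))} (A : AdaptedChart Y y V)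

/-- The derivative is put in the form required by transversality, with multipliers `2(g z - c)` and
`4C(‖z - r z‖² - ε)`; at a critical point both must vanish. -/
lemma hasFDerivAt_penalty {z : EuclideanSpace ℝ (Fin n)} (hz : z ∈ A.W)
    (c : EuclideanSpace ℝ (Fin n)) (C ε : ℝ) :
    ∃ F' : EuclideanSpace ℝ (Fin n) →L[ℝ] ℝ,
      HasFDerivAt (fun x => ‖A.g x - c‖ ^ 2 + C * (‖x - A.r x‖ ^ 2 - ε) ^ 2) F' z ∧
      ∀ v, F' v = inner ℝ ((2 : ℝ) • (A.g z - c)) (fderiv ℝ A.g z v) +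
        (4 * C * (‖z - A.r z‖ ^ 2 - ε)) * inner ℝ (z - A.r z) (v - fderiv ℝ A.r z v) := by
  have h1 := ((A.hasFDerivAt_g hz).sub_const c).norm_sq
  have h2 := ((((hasFDerivAt_id z).sub (A.hasFDerivAt_r hz)).norm_sq.sub_const ε).pow 2).const_mul C
  refine ⟨_, h1.add h2, fun v => ?_⟩
  simp [inner_smul_left, inner_sub_left, inner_sub_right]
  ring

/-- If both terms vanish at `x`, then `x = s (g x) = s (g y) = y`, which is not on the sphere;
compactness gives the bound. -/
lemma exists_sphere_bound (hy : y ∈ Y) {R : ℝ} (hR : 0 < R)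
    (hW : Metric.closedBall y R ⊆ A.W) :
    ∃ m > 0, ∀ x ∈ Metric.sphere y R, m ≤ ‖A.g x - A.g y‖ + ‖x - A.r x‖ ^ 2 := by
  have hsub : Metric.sphere y R ⊆ A.W := Metric.sphere_subset_closedBall.trans hW
  have hg : ContinuousOn A.g (Metric.sphere y R) := fun x hx =>
    (A.hasFDerivAt_g (hsub hx)).continuousAt.continuousWithinAt
  have hr : ContinuousOn A.r (Metric.sphere y R) := fun x hx =>
    (A.hasFDerivAt_r (hsub hx)).continuousAt.continuousWithinAt
  refine (isCompact_sphere y R).exists_forall_le' (a := 0)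
    ((hg.sub continuousOn_const).norm.add ((continuousOn_id.sub hr).norm.pow 2)) ?_
  intro x hx
  by_contra hcon
  change ¬ 0 < ‖A.g x - A.g y‖ + ‖x - A.r x‖ ^ 2 at hcon
  have h1 : ‖A.g x - A.g y‖ = 0 := by
    apply le_antisymm _ (norm_nonneg _)
    have : 0 ≤ ‖x - A.r x‖ ^ 2 := by positivity
    linarith
  have h2 : ‖x - A.r x‖ ^ 2 = 0 := by
    apply le_antisymm _ (by positivity)
    have : 0 ≤ ‖A.g x - A.g y‖ := by positivity
    linarith
  have h3 : A.g x = A.g y := sub_eq_zero.1 (norm_eq_zero.1 h1)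
  have h4 : x = A.r x := sub_eq_zero.1 (norm_eq_zero.1 (pow_eq_zero_iff (two_ne_zero) |>.1 h2))
  have h5 : x = y := by
    rw [h4, r, h3, A.s_g hy]
  rw [h5, mem_sphere_iff_norm, sub_self, norm_zero] at hx
  exact hR.ne hx

/-- If every point of `closure X \ Y` near `y` lies on a set `Z` along which `closure X` is
relatively open and on which `(g, ‖· - r‖²)` is a submersion, then `closure X` contains a
neighbourhood of `y` in `Y`. -/
lemma eventually_mem_closure (hy : y ∈ Y) {X : Set (EuclideanSpace ℝ (Fin n))}
    (hXY : Disjoint X Y) (hyX : y ∈ closure X)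
    (hcrit : ∀ᶠ z in 𝓝 y, z ∈ closure X → z ∉ Y → ∃ Z, z ∈ Z ∧
      (∀ᶠ z' in 𝓝[Z] z, z' ∈ closure X) ∧ ∀ a ∈ V, ∀ β : ℝ,
      (∀ v ∈ tangentSpace Z z, inner ℝ a (fderiv ℝ A.g z v) +
        β * inner ℝ (z - A.r z) (v - fderiv ℝ A.r z v) = 0) → a = 0 ∧ β = 0) :
    ∀ᶠ y' in 𝓝[Y] y, y' ∈ closure X := by
  obtain ⟨R, hR, hball⟩ := Metric.nhds_basis_closedBall.eventually_iff.1
    (hcrit.and A.W_mem_nhds)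
  have hDW : Metric.closedBall y R ⊆ A.W := fun x hx => (hball hx).2
  obtain ⟨m, hm, hsphere⟩ := A.exists_sphere_bound hy hR hDW
  set η : ℝ := m / 8 with hη
  have hηpos : 0 < η := by positivity
  have hgc : ContinuousAt A.g y := (A.hasFDerivAt_g A.mem_W).continuousAt
  have hg_near : ∀ᶠ x in 𝓝 y, ‖A.g x - A.g y‖ < η := by
    have := hgc.eventually (Metric.ball_mem_nhds _ hηpos)
    filter_upwards [this] with x hx
    rwa [dist_eq_norm] at hx
  have key : ∀ c ∈ V, ‖c - A.g y‖ < η → ∀ e > 0, ∃ z ∈ closure X,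
      A.g z = c ∧ ‖z - A.r z‖ ^ 2 < e := by
    intro c hcV hc e he
    have hρ_near : ∀ᶠ x in 𝓝 y, ‖x - A.r x‖ ^ 2 < min e (m / 6) := by
      have h1 : Tendsto (fun x => ‖x - A.r x‖ ^ 2) (𝓝 y) (𝓝 (‖y - y‖ ^ 2)) :=
        ((tendsto_id.sub (A.tendsto_r hy)).norm.pow 2)
      refine h1.eventually_lt_const ?_
      rw [sub_self, norm_zero, zero_pow two_ne_zero]
      positivity
    obtain ⟨x₀, ⟨⟨hx₀g, hx₀ρ⟩, hx₀b⟩, hx₀X⟩ :=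
      (mem_closure_iff_frequently.1 hyX).and_eventually
        ((hg_near.and hρ_near).and (Metric.closedBall_mem_nhds y hR)) |>.exists.imp
          fun _ h => h.symm
    set ε : ℝ := ‖x₀ - A.r x₀‖ ^ 2 with hε
    have hεpos : 0 < ε := by
      have : x₀ - A.r x₀ ≠ 0 := sub_ne_zero.2 (hXY.ne_of_mem hx₀X (A.r_mem (hDW hx₀b)))
      positivity
    have hεm : ε < m / 6 := hx₀ρ.trans_le (min_le_right _ _)
    -- The value at `x₀` is below `4η²`. On `Y` the penalty equals `5η²`; on the sphere, values
    -- below `4η²` would force `‖z - r z‖² ≥ 3ε` and hence a penalty of at least `20η²`. So the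
    -- minimizer is off `Y` and interior.
    set C : ℝ := 5 * η ^ 2 / ε ^ 2 with hC
    have hCpos : 0 < C := by positivity
    have hCε : C * ε ^ 2 = 5 * η ^ 2 := by
      rw [hC]; field_simp
    set F : EuclideanSpace ℝ (Fin n) → ℝ :=
      fun x => ‖A.g x - c‖ ^ 2 + C * (‖x - A.r x‖ ^ 2 - ε) ^ 2 with hF
    have hFc : ContinuousOn F (closure X ∩ Metric.closedBall y R) := fun x hx => by
      obtain ⟨F', h, -⟩ := A.hasFDerivAt_penalty (hDW hx.2) c C ε
      exact h.continuousAt.continuousWithinAt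
    have hKc : IsCompact (closure X ∩ Metric.closedBall y R) :=
      (isCompact_closedBall y R).inter_left isClosed_closure
    obtain ⟨z, ⟨hzX, hzD⟩, hzmin⟩ :=
      hKc.exists_isMinOn ⟨x₀, subset_closure hx₀X, hx₀b⟩ hFc
    have hFx₀ : F x₀ < 4 * η ^ 2 := by
      have h1 : ‖A.g x₀ - c‖ < 2 * η := by
        calc ‖A.g x₀ - c‖ = ‖(A.g x₀ - A.g y) - (c - A.g y)‖ := by congr 1; abel
          _ ≤ ‖A.g x₀ - A.g y‖ + ‖c - A.g y‖ := norm_sub_le _ _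
          _ < 2 * η := by linarith
      have h2 : F x₀ = ‖A.g x₀ - c‖ ^ 2 := by simp [hF, hε]
      rw [h2]
      nlinarith [norm_nonneg (A.g x₀ - c)]
    have hFz : F z < 4 * η ^ 2 := (hzmin ⟨subset_closure hx₀X, hx₀b⟩).trans_lt hFx₀
    have hz1 : ‖A.g z - c‖ ^ 2 < 4 * η ^ 2 := by
      have : 0 ≤ C * (‖z - A.r z‖ ^ 2 - ε) ^ 2 := by positivity
      simp only [hF] at hFz
      linarith
    have hz2 : C * (‖z - A.r z‖ ^ 2 - ε) ^ 2 < 4 * η ^ 2 := by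
      have : 0 ≤ ‖A.g z - c‖ ^ 2 := by positivity
      simp only [hF] at hFz
      linarith
    have hzY : z ∉ Y := by
      intro hzY
      rw [A.r_eq_self (hDW hzD) hzY, sub_self, norm_zero] at hz2
      nlinarith [sq_nonneg η]
    have hzball : z ∈ Metric.ball y R := by
      rw [← Metric.closedBall_sdiff_sphere]
      refine ⟨hzD, fun hzs => ?_⟩
      have hb := hsphere z hzs
      have h1 : ‖A.g z - c‖ < 2 * η := by
        refine lt_of_pow_lt_pow_left₀ 2 (by positivity) ?_
        linarith [mul_pow 2 η 2]
      have h2 : ‖A.g z - A.g y‖ < 3 * η := by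
        calc ‖A.g z - A.g y‖ = ‖(A.g z - c) + (c - A.g y)‖ := by congr 1; abel
          _ ≤ ‖A.g z - c‖ + ‖c - A.g y‖ := norm_add_le _ _
          _ < 3 * η := by linarith
      have h3 : 2 * ε ≤ ‖z - A.r z‖ ^ 2 - ε := by linarith
      have h4 : (2 * ε) ^ 2 ≤ (‖z - A.r z‖ ^ 2 - ε) ^ 2 := by
        gcongr
      have h5 := mul_le_mul_of_nonneg_left h4 hCpos.le
      nlinarith [sq_nonneg η]
    obtain ⟨Z, hzZ, hZX, htrans⟩ := (hball hzD).1 hzX hzY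
    have hmin : IsLocalExtrOn F Z z := by
      refine Or.inl ?_
      filter_upwards [hZX, mem_nhdsWithin_of_mem_nhds (Metric.isOpen_ball.mem_nhds hzball)]
        with x hx hxb using hzmin ⟨hx, Metric.ball_subset_closedBall hxb⟩
    obtain ⟨F', hF', hF'v⟩ := A.hasFDerivAt_penalty (hDW hzD) c C ε
    obtain ⟨ha, hβ⟩ := htrans ((2 : ℝ) • (A.g z - c))
      (V.smul_mem _ (V.sub_mem (A.g_mem z) hcV)) (4 * C * (‖z - A.r z‖ ^ 2 - ε)) (fun v hv => by
        rw [← hF'v]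
        exact IsLocalExtrOn.eq_zero_of_mem_tangentSpace hmin hF' hv)
    refine ⟨z, hzX, ?_, ?_⟩
    · exact sub_eq_zero.1 ((smul_eq_zero.1 ha).resolve_left two_ne_zero)
    · have h1 : ‖z - A.r z‖ ^ 2 - ε = 0 :=
        (mul_eq_zero.1 hβ).resolve_left (by positivity)
      rw [sub_eq_zero.1 h1]
      exact hx₀ρ.trans_le (min_le_left _ _)
  filter_upwards [mem_nhdsWithin_of_mem_nhds hg_near, mem_nhdsWithin_of_mem_nhds A.W_mem_nhds,
    self_mem_nhdsWithin] with y' hy'g hy'W hy'Y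
  rw [← closure_closure, Metric.mem_closure_iff]
  intro e he
  obtain ⟨z, hzX, hzg, hzρ⟩ := key (A.g y') (A.g_mem y') hy'g (e ^ 2) (by positivity)
  refine ⟨z, hzX, ?_⟩
  -- Equal `g`-coordinates give equal retractions, so `‖z - r z‖` is the distance from `z` to `y'`.
  have h1 : A.r z = y' := by rw [r, hzg, A.retr_eq y' hy'W hy'Y]
  rw [h1] at hzρ
  rw [dist_comm, dist_eq_norm]
  exact lt_of_pow_lt_pow_left₀ 2 he.le hzρ

end AdaptedChart

namespace IsWhitneyStratification

variable {n : ℕ} {M : Set (EuclideanSpace ℝ (Fin n))} {𝓜 : Set (Set (EuclideanSpace ℝ (Fin n)))}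

lemma dim_lt (hW : IsWhitneyStratification 𝓜 M) {X Y : Set (EuclideanSpace ℝ (Fin n))}
    (hX : X ∈ 𝓜) (hY : Y ∈ 𝓜) (hne : X ≠ Y) {y : EuclideanSpace ℝ (Fin n)} (hy : y ∈ Y)
    (hyX : y ∈ closure X) {d e : ℕ} (hd : IsSubmanifold d X) (he : IsSubmanifold e Y) : e < d := by
  obtain ⟨V, hV, ⟨A⟩⟩ := he.exists_adaptedChart hy
  have h := A.eventually_finrank_lt hy (hW.whitneyRegular X hX Y hY hne y hy)
    (hW.pairwiseDisjoint X hX Y hY hne)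
  obtain ⟨x, hxX, hx⟩ := ((mem_closure_iff_frequently.1 hyX).and_eventually h).exists
  rw [← hV, ← hd.finrank_tangentSpace hxX]
  exact hx hxX

/-- Induction runs downward on `dim Y`: points of `closure X` near `y` and off `Y` lie on strata of
larger dimension, where `closure X` is already relatively open. A minimizer over `closure X` is thus
a local minimizer on its stratum. -/
lemma eventually_mem_closure (hW : IsWhitneyStratification 𝓜 M) (hM : IsClosed M)
    {X Y : Set (EuclideanSpace ℝ (Fin n))} (hX : X ∈ 𝓜) (hY : Y ∈ 𝓜)
    {y : EuclideanSpace ℝ (Fin n)} (hy : y ∈ Y) (hyX : y ∈ closure X) :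
    ∀ᶠ y' in 𝓝[Y] y, y' ∈ closure X := by
  have main : ∀ m d : ℕ, n - d = m → ∀ Y ∈ 𝓜, IsSubmanifold d Y → ∀ y ∈ Y, y ∈ closure X →
      ∀ᶠ y' in 𝓝[Y] y, y' ∈ closure X := by
    intro m
    induction m using Nat.strong_induction_on with
    | _ m ih =>
    intro d hdm Y hY hd y hy hyX
    by_cases hXY : X = Y
    · subst hXY
      filter_upwards [self_mem_nhdsWithin] with x hx using subset_closure hx
    obtain ⟨V, hV, ⟨A⟩⟩ := hd.exists_adaptedChart hy
    refine A.eventually_mem_closure hy (hW.pairwiseDisjoint X hX Y hY hXY) hyX ?_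
    have hyM : y ∈ M := hW.sUnion_eq ▸ mem_sUnion_of_mem hy hY
    obtain ⟨U, hU, hfin⟩ := hW.locallyFinite y hyM
    have hall : ∀ᶠ z in 𝓝 y, ∀ S ∈ {S | S ∈ 𝓜 ∧ (S ∩ U).Nonempty}, S ≠ Y → z ∈ S →
        Module.finrank ℝ V < Module.finrank ℝ (tangentSpace S z) ∧ ∀ a ∈ V, ∀ β : ℝ,
          (∀ v ∈ tangentSpace S z, inner ℝ a (fderiv ℝ A.g z v) +
          β * inner ℝ (z - A.r z) (v - fderiv ℝ A.r z v) = 0) → a = 0 ∧ β = 0 := by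
      rw [eventually_all_finite hfin]
      intro S hS
      by_cases hSY : S = Y
      · exact Eventually.of_forall fun z h => absurd hSY h
      · have h1 := hW.whitneyRegular S hS.1 Y hY hSY y hy
        have h2 := hW.pairwiseDisjoint S hS.1 Y hY hSY
        filter_upwards [A.eventually_finrank_lt hy h1 h2, A.eventually_transverse hy h1 h2]
          with z h3 h4 _ hz using ⟨h3 hz, h4 hz⟩
    filter_upwards [hall, hU] with z hz hzU hzX hzY
    have hzM : z ∈ M := by
      refine closure_minimal ?_ hM hzX
      rw [← hW.sUnion_eq]
      exact subset_sUnion_of_mem hX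
    rw [← hW.sUnion_eq] at hzM
    obtain ⟨Z, hZ, hzZ⟩ := hzM
    have hZY : Z ≠ Y := fun h => hzY (h ▸ hzZ)
    obtain ⟨hrank, htrans⟩ := hz Z ⟨hZ, z, hzZ, hzU⟩ hZY hzZ
    refine ⟨Z, hzZ, ?_, htrans⟩
    obtain ⟨e, he⟩ := hW.isSubmanifold Z hZ
    rw [hV, he.finrank_tangentSpace hzZ] at hrank
    have hen := he.1
    exact ih (n - e) (by omega) e rfl Z hZ he z hzZ hzX
  obtain ⟨d, hd⟩ := hW.isSubmanifold Y hY
  exact main _ d rfl Y hY hd y hy hyX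

/-- The frontier condition for Whitney stratifications with connected strata. -/
lemma subset_closure_of_mem (hW : IsWhitneyStratification 𝓜 M) (hM : IsClosed M)
    {X Y : Set (EuclideanSpace ℝ (Fin n))} (hX : X ∈ 𝓜) (hY : Y ∈ 𝓜) (hYc : IsPreconnected Y)
    {y : EuclideanSpace ℝ (Fin n)} (hy : y ∈ Y) (hyX : y ∈ closure X) : Y ⊆ closure X := by
  have : PreconnectedSpace Y := Subtype.preconnectedSpace hYc
  have hclopen : IsClopen ((↑) ⁻¹' closure X : Set Y) := by
    refine ⟨isClosed_closure.preimage continuous_subtype_val, isOpen_iff_mem_nhds.2 ?_⟩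
    intro x hx
    exact (eventually_nhds_subtype_iff Y x (· ∈ closure X)).2
      (hW.eventually_mem_closure hM hX hY x.2 hx)
  have huniv := hclopen.eq_univ ⟨⟨y, hy⟩, hyX⟩
  intro x hx
  have : (⟨x, hx⟩ : Y) ∈ ((↑) ⁻¹' closure X : Set Y) := huniv ▸ mem_univ _
  exact this

end IsWhitneyStratification

end MonotonicStratification

/-! ### Monotonicity and coordinate functions on strata. -/

namespace MonotonicStratification

variable {n : ℕ}

lemma map_coordinateProjection_eq_top_iff {I : Finset (Fin n)}
    {T : Submodule ℝ (EuclideanSpace ℝ (Fin n))} :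
    T.map (coordinateProjection I) = ⊤ ↔
      ∀ u : EuclideanSpace ℝ (Fin n), ∃ v ∈ T, ∀ i ∉ I, v i = u i := by
  constructor
  · intro h u
    have : coordinateProjection I u ∈ T.map (coordinateProjection I) := h ▸ Submodule.mem_top
    obtain ⟨v, hv, hvu⟩ := this
    refine ⟨v, hv, fun i hi => ?_⟩
    have := congrArg (fun w : coordinatePlane I => (w : EuclideanSpace ℝ (Fin n)) i) hvu
    simpa [coordinateProjection, hi] using this
  · intro h
    rw [eq_top_iff]
    intro u _
    obtain ⟨v, hv, hvu⟩ := h u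
    refine ⟨v, hv, ?_⟩
    ext i
    by_cases hi : i ∈ I
    · simp [coordinateProjection, hi, u.2 i hi]
    · simp [coordinateProjection, hi, hvu i hi]

/-- Constant rank is used only in this form: surjectivity onto a coordinate plane at one point
carries over to all points. -/
lemma IsMonotonic.forall_exists {S : Set (EuclideanSpace ℝ (Fin n))} (hS : IsMonotonic S)
    {p q : EuclideanSpace ℝ (Fin n)} (hp : p ∈ S) (hq : q ∈ S) {I : Finset (Fin n)}
    (h : ∀ u : EuclideanSpace ℝ (Fin n), ∃ v ∈ tangentSpace S p, ∀ i ∉ I, v i = u i) :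
    ∀ u : EuclideanSpace ℝ (Fin n), ∃ v ∈ tangentSpace S q, ∀ i ∉ I, v i = u i := by
  rw [← map_coordinateProjection_eq_top_iff] at h ⊢
  obtain ⟨r, hr⟩ := hS I
  have h1 := hr p hp
  have h2 := hr q hq
  rw [rankAt] at h1 h2
  rw [h, finrank_top] at h1
  exact Submodule.eq_top_of_finrank_eq (h2.trans h1.symm)

lemma IsMonotonic.exists_ne_zero {S : Set (EuclideanSpace ℝ (Fin n))} (hS : IsMonotonic S)
    {p q : EuclideanSpace ℝ (Fin n)} (hp : p ∈ S) (hq : q ∈ S) {k : Fin n}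
    (h : ∃ v ∈ tangentSpace S p, v k ≠ 0) : ∃ v ∈ tangentSpace S q, v k ≠ 0 := by
  obtain ⟨v, hv, hvk⟩ := h
  obtain ⟨w, hw, hwk⟩ := hS.forall_exists hp hq (I := {k}ᶜ) (fun u => by
    refine ⟨(u k / v k) • v, Submodule.smul_mem _ _ hv, fun i hi => ?_⟩
    obtain rfl : i = k := by simpa using hi
    simp [hvk]) (EuclideanSpace.single k 1)
  refine ⟨w, hw, ?_⟩
  rw [hwk k (by simp)]
  simp

/-- The triangular pair `v`, `w` shows that `(x_k, x_j)` has rank two at `p`, hence also at `q`. -/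
lemma IsMonotonic.exists_pair {S : Set (EuclideanSpace ℝ (Fin n))} (hS : IsMonotonic S)
    {p q : EuclideanSpace ℝ (Fin n)} (hp : p ∈ S) (hq : q ∈ S) {k j : Fin n}
    {v w : EuclideanSpace ℝ (Fin n)} (hv : v ∈ tangentSpace S p) (hvk : v k ≠ 0)
    (hw : w ∈ tangentSpace S p) (hwk : w k = 0) (hwj : w j ≠ 0) (a b : ℝ) :
    ∃ z ∈ tangentSpace S q, z k = a ∧ z j = b := by
  have hjk : j ≠ k := fun h => hwj (h ▸ hwk)
  obtain ⟨z, hz, hzu⟩ := hS.forall_exists hp hq (I := {k, j}ᶜ) (fun u => by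
    refine ⟨(u k / v k) • v + ((u j - u k / v k * v j) / w j) • w,
      Submodule.add_mem _ (Submodule.smul_mem _ _ hv) (Submodule.smul_mem _ _ hw), fun i hi => ?_⟩
    have hi' : i = k ∨ i = j := by simpa [or_iff_not_imp_left] using hi
    rcases hi' with rfl | rfl
    · simp [hvk, hwk]
    · simp [hwj]) (EuclideanSpace.single k a + EuclideanSpace.single j b)
  refine ⟨z, hz, ?_, ?_⟩
  · rw [hzu k (by simp)]; simp [hjk.symm]
  · rw [hzu j (by simp)]; simp [hjk]

lemma hasFDerivAt_coord (k : Fin n) (z : EuclideanSpace ℝ (Fin n)) :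
    HasFDerivAt (fun x : EuclideanSpace ℝ (Fin n) => x k)
      (EuclideanSpace.proj (𝕜 := ℝ) k : EuclideanSpace ℝ (Fin n) →L[ℝ] ℝ) z :=
  (EuclideanSpace.proj (𝕜 := ℝ) k : EuclideanSpace ℝ (Fin n) →L[ℝ] ℝ).hasFDerivAt

lemma continuous_coord (k : Fin n) : Continuous fun x : EuclideanSpace ℝ (Fin n) => x k := by
  fun_prop

lemma IsLocalExtrOn.coord_eq_zero {S : Set (EuclideanSpace ℝ (Fin n))}
    {z : EuclideanSpace ℝ (Fin n)} {k : Fin n} (h : IsLocalExtrOn (fun x => x k) S z)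
    {v : EuclideanSpace ℝ (Fin n)} (hv : v ∈ tangentSpace S z) : v k = 0 :=
  IsLocalExtrOn.eq_zero_of_mem_tangentSpace h (hasFDerivAt_coord k z) hv

lemma deriv_mem_tangentSpace {S : Set (EuclideanSpace ℝ (Fin n))}
    {γ : ℝ → EuclideanSpace ℝ (Fin n)} {t : ℝ} (hγ : ContDiffAt ℝ ∞ γ t)
    (hS : ∀ᶠ τ in 𝓝 t, γ τ ∈ S) : deriv γ t ∈ tangentSpace S (γ t) := by
  have hγ' : ContDiffAt ℝ ∞ γ (t + 0) := by simpa using hγ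
  refine Submodule.subset_span ⟨fun τ => γ (t + τ), ?_, by simp, ?_, ?_⟩
  · exact hγ'.comp (0 : ℝ) (by fun_prop)
  · have : Tendsto (fun τ : ℝ => t + τ) (𝓝 0) (𝓝 t) := by
      simpa using (continuous_const_add t).tendsto 0
    exact this.eventually hS
  · rw [deriv_comp_const_add]; simp

lemma hasDerivAt_coord_zero {S : Set (EuclideanSpace ℝ (Fin n))} {k : Fin n}
    (h : ∀ p ∈ S, ∀ v ∈ tangentSpace S p, v k = 0)
    {γ : ℝ → EuclideanSpace ℝ (Fin n)} {t : ℝ} (hγ : ContDiffAt ℝ ∞ γ t)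
    (hS : ∀ᶠ τ in 𝓝 t, γ τ ∈ S) : HasDerivAt (fun τ => γ τ k) 0 t := by
  have h1 := (hasFDerivAt_coord k (γ t)).comp_hasDerivAt t
    (hγ.differentiableAt (by simp)).hasDerivAt
  have h2 : (EuclideanSpace.proj (𝕜 := ℝ) k : EuclideanSpace ℝ (Fin n) →L[ℝ] ℝ) (deriv γ t) = 0 :=
    h _ hS.self_of_nhds _ (deriv_mem_tangentSpace hγ hS)
  rw [h2] at h1
  exact h1

namespace AdaptedChart

variable {Y : Set (EuclideanSpace ℝ (Fin n))} {y : EuclideanSpace ℝ (Fin n)}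
  {V : Submodule ℝ (EuclideanSpace ℝ (Fin n))} (A : AdaptedChart Y y V)

lemma eventually_contDiffAt_s (hy : y ∈ Y) :
    ∀ᶠ c in 𝓝 (A.g y), c ∈ V → A.s c ∈ Y ∧ ContDiffAt ℝ ∞ A.s c := by
  have hs : Tendsto A.s (𝓝 (A.g y)) (𝓝 y) := by
    simpa [A.s_g hy] using A.hasFDerivAt_s.continuousAt.tendsto
  filter_upwards [A.eventually_s, hs.eventually A.W_mem_nhds] with c hc hcW hcV
  obtain ⟨h1, h2⟩ := hc hcV
  refine ⟨h1, ?_⟩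
  rw [← h2]
  exact A.contDiffAt_s _ hcW

lemma eventually_coord_eq (A : AdaptedChart Y y V) (hy : y ∈ Y) {k : Fin n}
    (h : ∀ p ∈ Y, ∀ v ∈ tangentSpace Y p, v k = 0) : ∀ᶠ x in 𝓝[Y] y, x k = y k := by
  obtain ⟨δ, hδ, hball⟩ := Metric.nhds_basis_ball.eventually_iff.1 (A.eventually_contDiffAt_s hy)
  have hg : ∀ᶠ x in 𝓝 y, A.g x ∈ Metric.ball (A.g y) δ :=
    (A.hasFDerivAt_g A.mem_W).continuousAt.eventually (Metric.ball_mem_nhds _ hδ)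
  filter_upwards [mem_nhdsWithin_of_mem_nhds hg, mem_nhdsWithin_of_mem_nhds A.W_mem_nhds,
    self_mem_nhdsWithin] with x hxg hxW hxY
  -- The segment in `V` lifts through `s` to a curve in `Y` from `y` to `x`, along which the
  -- coordinate has zero derivative.
  set l : ℝ → EuclideanSpace ℝ (Fin n) := fun t => A.g y + t • (A.g x - A.g y) with hl
  have hlc : ContDiff ℝ ∞ l := by fun_prop
  have hlV : ∀ t, l t ∈ V := fun t =>
    V.add_mem (A.g_mem y) (V.smul_mem _ (V.sub_mem (A.g_mem x) (A.g_mem y)))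
  have hlball : ∀ t ∈ Icc (0 : ℝ) 1, l t ∈ Metric.ball (A.g y) δ := by
    intro t ht
    exact (convex_ball _ _).add_smul_sub_mem (Metric.mem_ball_self hδ) hxg ht
  have hsm : ∀ t ∈ Icc (0 : ℝ) 1, ContDiffAt ℝ ∞ (A.s ∘ l) t := fun t ht =>
    (hball (hlball t ht) (hlV t)).2.comp t hlc.contDiffAt
  have hder : ∀ t ∈ Icc (0 : ℝ) 1, HasDerivAt (fun t => (A.s ∘ l) t k) 0 t := by
    intro t ht
    have h1 : ∀ᶠ τ in 𝓝 t, (A.s ∘ l) τ ∈ Y := by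
      filter_upwards [hlc.continuous.continuousAt.eventually
        (Metric.isOpen_ball.mem_nhds (hlball t ht))] with τ hτ using (hball hτ (hlV τ)).1
    exact hasDerivAt_coord_zero h (hsm t ht) h1
  have hconst := constant_of_has_deriv_right_zero
    (fun t ht => (hder t ht).continuousAt.continuousWithinAt)
    (fun t ht => (hder t (Ico_subset_Icc_self ht)).hasDerivWithinAt) 1 (by simp)
  simpa [hl, A.s_g hy, A.retr_eq x hxW hxY] using hconst

/-- Lagrange multipliers for two coordinate functions on a submanifold. -/
lemma exists_multipliers (A : AdaptedChart Y y V) (hy : y ∈ Y) {k j : Fin n}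
    (h : IsLocalExtrOn (fun x => x j) (Y ∩ {x | x k = y k}) y) :
    ∃ a b : ℝ, (a, b) ≠ 0 ∧ ∀ v ∈ tangentSpace Y y, a * v k + b * v j = 0 := by
  -- Parametrizing `Y` by `V` reduces the claim to Lagrange multipliers on a normed space.
  set l : V → EuclideanSpace ℝ (Fin n) := fun u => A.g y + u with hl
  have hl0 : l 0 = A.g y := by simp [hl]
  have hld : HasStrictFDerivAt l V.subtypeL 0 :=
    V.subtypeL.hasStrictFDerivAt.const_add (A.g y)
  have hlt : Tendsto l (𝓝 0) (𝓝 (A.g y)) := by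
    rw [← hl0]; exact hld.hasFDerivAt.continuousAt.tendsto
  have hs : HasStrictFDerivAt A.s (fderiv ℝ A.s (A.g y)) (l 0) := by
    rw [hl0]; exact (A.contDiffAt_s y A.mem_W).hasStrictFDerivAt (by simp)
  have hcoord : ∀ i : Fin n, HasStrictFDerivAt (fun u => A.s (l u) i)
      ((EuclideanSpace.proj (𝕜 := ℝ) i : EuclideanSpace ℝ (Fin n) →L[ℝ] ℝ).comp
        ((fderiv ℝ A.s (A.g y)).comp V.subtypeL)) 0 := fun i =>
    (EuclideanSpace.proj (𝕜 := ℝ) i : EuclideanSpace ℝ (Fin n) →L[ℝ] ℝ).hasStrictFDerivAt.comp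
      (0 : V) (hs.comp (0 : V) hld)
  have hs0 : A.s (l 0) = y := by rw [hl0, A.s_g hy]
  have hst : Tendsto (fun u => A.s (l u)) (𝓝 0) (𝓝 y) := by
    have := (hs.comp (0 : V) hld).hasFDerivAt.continuousAt.tendsto
    simpa [Function.comp_def, hs0] using this
  have hmaps : Tendsto (fun u => A.s (l u)) (𝓝[{u | A.s (l u) k = A.s (l 0) k}] 0)
      (𝓝[Y ∩ {x | x k = y k}] y) := by
    refine tendsto_nhdsWithin_iff.2 ⟨hst.mono_left nhdsWithin_le_nhds, ?_⟩
    filter_upwards [self_mem_nhdsWithin,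
      mem_nhdsWithin_of_mem_nhds (hlt.eventually A.eventually_s)] with u hu1 hu2
    refine ⟨(hu2 (V.add_mem (A.g_mem y) u.2)).1, ?_⟩
    simpa [hs0] using hu1
  have hext : IsLocalExtrOn (fun u => A.s (l u) j) {u | A.s (l u) k = A.s (l 0) k} 0 := by
    rcases h with h | h
    · left
      filter_upwards [hmaps.eventually h] with u hu
      simpa [hs0] using hu
    · right
      filter_upwards [hmaps.eventually h] with u hu
      simpa [hs0] using hu
  obtain ⟨a, b, hab, heq⟩ := hext.exists_multipliers_of_hasStrictFDerivAt_1d (hcoord k) (hcoord j)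
  refine ⟨a, b, hab, fun v hv => ?_⟩
  have h1 := congrArg (fun f => f ⟨fderiv ℝ A.g y v, A.fderiv_g_mem v⟩) heq
  have h2 : fderiv ℝ A.s (A.g y) (fderiv ℝ A.g y v) = v := by
    have := A.fderiv_r_eq_self hv
    rwa [A.fderiv_r] at this
  simpa [h2] using h1

end AdaptedChart

lemma IsSubmanifold.coord_eq {d : ℕ} {S : Set (EuclideanSpace ℝ (Fin n))}
    (hS : IsSubmanifold d S) (hc : IsPreconnected S) {k : Fin n}
    (h : ∀ p ∈ S, ∀ v ∈ tangentSpace S p, v k = 0) {p q : EuclideanSpace ℝ (Fin n)}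
    (hp : p ∈ S) (hq : q ∈ S) : p k = q k := by
  have : PreconnectedSpace S := Subtype.preconnectedSpace hc
  have hlc : IsLocallyConstant fun x : S => (x : EuclideanSpace ℝ (Fin n)) k := by
    rw [IsLocallyConstant.iff_eventually_eq]
    intro x
    obtain ⟨V, -, ⟨A⟩⟩ := hS.exists_adaptedChart x.2
    exact (eventually_nhds_subtype_iff S x fun z => z k = (x : EuclideanSpace ℝ (Fin n)) k).2
      (A.eventually_coord_eq x.2 h)
  exact hlc.apply_eq_of_preconnectedSpace ⟨p, hp⟩ ⟨q, hq⟩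

lemma IsSubmanifold.eq_zero_of_mem_tangentSpace {S : Set (EuclideanSpace ℝ (Fin n))}
    (hS : IsSubmanifold 0 S) {p : EuclideanSpace ℝ (Fin n)} (hp : p ∈ S)
    {v : EuclideanSpace ℝ (Fin n)} (hv : v ∈ tangentSpace S p) : v = 0 := by
  have h := Submodule.finrank_eq_zero.1 (hS.finrank_tangentSpace hp)
  rwa [h, Submodule.mem_bot] at hv

/-- A submanifold of positive dimension has a coordinate which is nonconstant to first order. -/
lemma IsSubmanifold.exists_coord_ne_zero {d : ℕ} {S : Set (EuclideanSpace ℝ (Fin n))}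
    (hS : IsSubmanifold d S) (hd : d ≠ 0) {p : EuclideanSpace ℝ (Fin n)} (hp : p ∈ S) :
    ∃ j, ∃ v ∈ tangentSpace S p, v j ≠ 0 := by
  have h : tangentSpace S p ≠ ⊥ := fun h => hd (by
    rw [← hS.finrank_tangentSpace hp, h, finrank_bot])
  obtain ⟨v, hv, hv0⟩ := Submodule.exists_mem_ne_zero_of_ne_bot h
  by_contra! hcon
  exact hv0 (by ext j; exact hcon j v hv)

lemma IsSubmanifold.exists_coord_ne_zero_of_two_le {d : ℕ} {S : Set (EuclideanSpace ℝ (Fin n))}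
    (hS : IsSubmanifold d S) (hd : 2 ≤ d) {p : EuclideanSpace ℝ (Fin n)} (hp : p ∈ S)
    (k : Fin n) : ∃ j, ∃ w ∈ tangentSpace S p, w k = 0 ∧ w j ≠ 0 := by
  let f : tangentSpace S p →ₗ[ℝ] ℝ :=
    (EuclideanSpace.projₗ (𝕜 := ℝ) k).comp (tangentSpace S p).subtype
  have hker : LinearMap.ker f ≠ ⊥ := by
    apply LinearMap.ker_ne_bot_of_finrank_lt
    rw [hS.finrank_tangentSpace hp, Module.finrank_self]
    omega
  obtain ⟨w, hw, hw0⟩ := Submodule.exists_mem_ne_zero_of_ne_bot hker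
  by_contra! hcon
  refine hw0 (Subtype.ext ?_)
  ext j
  exact hcon j w w.2 hw

end MonotonicStratification

/-! ### Extreme values and level sets: descent to low-dimensional strata. -/

namespace MonotonicStratification

variable {n : ℕ}

lemma rankAt_projₗ_eq_one {S : Set (EuclideanSpace ℝ (Fin n))} {p : EuclideanSpace ℝ (Fin n)}
    {k : Fin n} (h : ∃ v ∈ tangentSpace S p, v k ≠ 0) :
    rankAt (EuclideanSpace.projₗ (𝕜 := ℝ) k) S p = 1 := by
  obtain ⟨v, hv, hvk⟩ := h
  have htop : (tangentSpace S p).map (EuclideanSpace.projₗ (𝕜 := ℝ) k) = ⊤ := by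
    rw [eq_top_iff]
    intro c _
    exact ⟨(c / v k) • v, Submodule.smul_mem _ _ hv, by simp [hvk]⟩
  rw [rankAt, htop, finrank_top, Module.finrank_self]

lemma le_on_closure {X : Set (EuclideanSpace ℝ (Fin n))} {k : Fin n} {a : ℝ}
    (h : (∀ x ∈ X, a ≤ x k) ∨ ∀ x ∈ X, x k ≤ a) :
    (∀ x ∈ closure X, a ≤ x k) ∨ ∀ x ∈ closure X, x k ≤ a :=
  h.imp
    (fun h => closure_minimal h (isClosed_le continuous_const (continuous_coord k)))
    (fun h => closure_minimal h (isClosed_le (continuous_coord k) continuous_const))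

lemma isLocalExtrOn_of_le {X : Set (EuclideanSpace ℝ (Fin n))} {k : Fin n}
    {y : EuclideanSpace ℝ (Fin n)}
    (h : (∀ x ∈ X, y k ≤ x k) ∨ ∀ x ∈ X, x k ≤ y k) :
    IsLocalExtrOn (fun x => x k) X y :=
  h.imp (fun h => eventually_of_mem self_mem_nhdsWithin h)
    (fun h => eventually_of_mem self_mem_nhdsWithin h)

lemma le_or_ge_of_notMem_interior {s : Set ℝ} (hs : IsPreconnected s) {a : ℝ}
    (ha : a ∉ interior s) : (∀ x ∈ s, a ≤ x) ∨ ∀ x ∈ s, x ≤ a := by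
  by_contra! h
  obtain ⟨⟨p, hp, hpa⟩, q, hq, haq⟩ := h
  exact ha (mem_interior_iff_mem_nhds.2
    (mem_of_superset (Icc_mem_nhds hpa haq) (hs.ordConnected.out hp hq)))

namespace IsWhitneyStratification

variable {M : Set (EuclideanSpace ℝ (Fin n))} {𝓜 : Set (Set (EuclideanSpace ℝ (Fin n)))}

lemma closure_subset (hW : IsWhitneyStratification 𝓜 M) (hM : IsClosed M)
    {X : Set (EuclideanSpace ℝ (Fin n))} (hX : X ∈ 𝓜) : closure X ⊆ M :=
  closure_minimal (hW.sUnion_eq ▸ subset_sUnion_of_mem hX) hM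

lemma isCompact_closure (hW : IsWhitneyStratification 𝓜 M) (hM : IsCompact M)
    {X : Set (EuclideanSpace ℝ (Fin n))} (hX : X ∈ 𝓜) : IsCompact (closure X) :=
  hM.of_isClosed_subset isClosed_closure (hW.closure_subset hM.isClosed hX)

/-- Each point of the closure of a stratum lies on a stratum contained in that closure, which is
of smaller dimension unless it is the given stratum. -/
lemma exists_stratum_subset_closure (hW : IsWhitneyStratification 𝓜 M) (hM : IsClosed M)
    (hconn : ∀ S ∈ 𝓜, IsConnected S) {X : Set (EuclideanSpace ℝ (Fin n))} (hX : X ∈ 𝓜) {d : ℕ}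
    (hd : IsSubmanifold d X) {z : EuclideanSpace ℝ (Fin n)} (hz : z ∈ closure X) :
    ∃ Z ∈ 𝓜, z ∈ Z ∧ Z ⊆ closure X ∧ (z ∉ X → ∃ e < d, IsSubmanifold e Z) := by
  have hzM := hW.closure_subset hM hX hz
  rw [← hW.sUnion_eq] at hzM
  obtain ⟨Z, hZ, hzZ⟩ := hzM
  refine ⟨Z, hZ, hzZ, hW.subset_closure_of_mem hM hX hZ (hconn Z hZ).isPreconnected hzZ hz,
    fun hzX => ?_⟩
  obtain ⟨e, he⟩ := hW.isSubmanifold Z hZ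
  exact ⟨e, hW.dim_lt hX hZ (fun h => hzX (h ▸ hzZ)) hzZ hz hd he, he⟩

/-- An extreme value of a coordinate which is attained on a stratum is attained on a
`0`-dimensional stratum. -/
lemma mem_skeleton_of_extreme (hW : IsWhitneyStratification 𝓜 M) (hM : IsCompact M)
    (hmono : ∀ S ∈ 𝓜, IsMonotonic S) (hconn : ∀ S ∈ 𝓜, IsConnected S) (k : Fin n) (a : ℝ) (d : ℕ) :
    ∀ Y ∈ 𝓜, IsSubmanifold d Y → (∃ y ∈ Y, y k = a) →
      ((∀ x ∈ Y, a ≤ x k) ∨ ∀ x ∈ Y, x k ≤ a) → ∃ q ∈ skeleton 𝓜 0, q k = a := by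
  induction d using Nat.strong_induction_on with
  | _ d ih =>
  rintro Y hY hd ⟨y, hy, rfl⟩ hext
  rcases eq_or_ne d 0 with rfl | hd0
  · exact ⟨y, ⟨Y, ⟨hY, 0, le_rfl, hd⟩, hy⟩, rfl⟩
  -- The coordinate is critical at the extremum `y`, so monotonicity makes it critical everywhere on
  -- `Y`.
  have hzero : ∀ p ∈ Y, ∀ v ∈ tangentSpace Y p, v k = 0 := by
    by_contra! hcon
    obtain ⟨p, hp, v, hv, hvk⟩ := hcon
    obtain ⟨w, hw, hwk⟩ := (hmono Y hY).exists_ne_zero hp hy ⟨v, hv, hvk⟩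
    exact hwk (IsLocalExtrOn.coord_eq_zero (isLocalExtrOn_of_le hext) hw)
  have hconst : ∀ x ∈ closure Y, x k = y k :=
    closure_minimal (fun x hx => hd.coord_eq (hconn Y hY).isPreconnected hzero hx hy)
      (isClosed_eq (continuous_coord k) continuous_const)
  obtain ⟨j, hj⟩ := hd.exists_coord_ne_zero hd0 hy
  obtain ⟨z, hz, hmax⟩ := (hW.isCompact_closure hM hY).exists_isMaxOn ⟨y, subset_closure hy⟩
    (continuous_coord j).continuousOn
  have hzY : z ∉ Y := by
    intro hzY
    obtain ⟨w, hw, hwj⟩ := (hmono Y hY).exists_ne_zero hy hzY hj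
    exact hwj (IsLocalExtrOn.coord_eq_zero
      (isLocalExtrOn_of_le (Or.inr fun x hx => hmax (subset_closure hx))) hw)
  obtain ⟨Z, hZ, hzZ, hZY, hdim⟩ :=
    hW.exists_stratum_subset_closure hM.isClosed hconn hY hd hz
  obtain ⟨e, hed, he⟩ := hdim hzY
  -- Extremality on `Z` is automatic, the coordinate being constant on `closure Y`.
  exact ih e hed Z hZ he ⟨z, hzZ, hconst z hz⟩
    (Or.inl fun x hx => (hconst x (hZY hx)).ge)

/-- A boundary value of the interval `π(X)` is extreme on `closure X` and, by compactness, attained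
there on some stratum. -/
lemma frontier_image_subset (hW : IsWhitneyStratification 𝓜 M) (hM : IsCompact M)
    (hmono : ∀ S ∈ 𝓜, IsMonotonic S) (hconn : ∀ S ∈ 𝓜, IsConnected S) (k : Fin n)
    {X : Set (EuclideanSpace ℝ (Fin n))} (hX : X ∈ 𝓜) :
    frontier ((fun x : EuclideanSpace ℝ (Fin n) => x k) '' X) ⊆
      (fun x : EuclideanSpace ℝ (Fin n) => x k) '' skeleton 𝓜 0 := by
  rintro a ⟨hacl, haint⟩
  have hpre := (hconn X hX).isPreconnected.image _ (continuous_coord k).continuousOn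
  have hext : (∀ x ∈ X, a ≤ x k) ∨ ∀ x ∈ X, x k ≤ a := by
    simpa [forall_mem_image] using le_or_ge_of_notMem_interior hpre haint
  have hcomp := (hW.isCompact_closure hM hX).image (continuous_coord k)
  obtain ⟨y, hy, hya⟩ := closure_minimal (image_mono subset_closure) hcomp.isClosed hacl
  obtain ⟨d, hd⟩ := hW.isSubmanifold X hX
  obtain ⟨Y, hY, hyY, hYX, -⟩ := hW.exists_stratum_subset_closure hM.isClosed hconn hX hd hy
  obtain ⟨e, he⟩ := hW.isSubmanifold Y hY
  exact hW.mem_skeleton_of_extreme hM hmono hconn k a e Y hY he ⟨y, hyY, hya⟩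
    ((le_on_closure hext).imp (fun h x hx => h x (hYX hx)) (fun h x hx => h x (hYX hx)))

/-- A value of a coordinate on a stratum which is not attained on a `0`-dimensional stratum is
attained on a `1`-dimensional stratum in the closure on which the coordinate has rank one. -/
lemma exists_one_dim_stratum (hW : IsWhitneyStratification 𝓜 M) (hM : IsCompact M)
    (hmono : ∀ S ∈ 𝓜, IsMonotonic S) (hconn : ∀ S ∈ 𝓜, IsConnected S) (k : Fin n) (c : ℝ)
    (hc : ∀ q ∈ skeleton 𝓜 0, q k ≠ c) (d : ℕ) :
    ∀ Y ∈ 𝓜, IsSubmanifold d Y → (∃ y ∈ Y, y k = c) →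
      ∃ S ∈ 𝓜, IsSubmanifold 1 S ∧ S ⊆ closure Y ∧ (∃ p ∈ S, p k = c) ∧
        ∀ p ∈ S, ∃ v ∈ tangentSpace S p, v k ≠ 0 := by
  induction d using Nat.strong_induction_on with
  | _ d ih =>
  rintro Y hY hd ⟨y, hy, hyc⟩
  have hne : ∀ p ∈ Y, ∃ v ∈ tangentSpace Y p, v k ≠ 0 := by
    by_contra! hcon
    obtain ⟨p, hp, hpk⟩ := hcon
    have hzero : ∀ q ∈ Y, ∀ v ∈ tangentSpace Y q, v k = 0 := by
      intro q hq v hv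
      by_contra hvk
      obtain ⟨w, hw, hwk⟩ := (hmono Y hY).exists_ne_zero hq hp ⟨v, hv, hvk⟩
      exact hwk (hpk w hw)
    obtain ⟨q, hq, hqc⟩ := hW.mem_skeleton_of_extreme hM hmono hconn k c d Y hY hd ⟨y, hy, hyc⟩
      (Or.inl fun x hx =>
        (hyc.symm.trans (hd.coord_eq (hconn Y hY).isPreconnected hzero hy hx)).le)
    exact hc q hq hqc
  have hd0 : d ≠ 0 := by
    rintro rfl
    exact hc y ⟨Y, ⟨hY, 0, le_rfl, hd⟩, hy⟩ hyc
  rcases eq_or_ne d 1 with rfl | hd1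
  · exact ⟨Y, hY, hd, subset_closure, ⟨y, hy, hyc⟩, hne⟩
  obtain ⟨v, hv, hvk⟩ := hne y hy
  obtain ⟨j, w, hw, hwk, hwj⟩ := hd.exists_coord_ne_zero_of_two_le (by omega) hy k
  have hclosed : IsClosed {x : EuclideanSpace ℝ (Fin n) | x k = c} :=
    isClosed_eq (continuous_coord k) continuous_const
  obtain ⟨z, ⟨hz, hzc⟩, hmax⟩ := ((hW.isCompact_closure hM hY).inter_right hclosed).exists_isMaxOn
    ⟨y, subset_closure hy, hyc⟩ (continuous_coord j).continuousOn
  have hzc' : z k = c := hzc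
  have hzY : z ∉ Y := by
    intro hzY
    obtain ⟨V, -, ⟨A⟩⟩ := hd.exists_adaptedChart hzY
    have hext : IsLocalExtrOn (fun x : EuclideanSpace ℝ (Fin n) => x j)
        (Y ∩ {x | x k = z k}) z :=
      isLocalExtrOn_of_le (Or.inr fun x hx => hmax ⟨subset_closure hx.1, hx.2.trans hzc'⟩)
    obtain ⟨a, b, hab, hvan⟩ := A.exists_multipliers hzY hext
    -- A tangent vector whose two coordinates equal the multipliers turns the Lagrange relation into
    -- `a² + b² = 0`.
    obtain ⟨u, hu, huk, huj⟩ := (hmono Y hY).exists_pair hy hzY hv hvk hw hwk hwj a b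
    have h := hvan u hu
    rw [huk, huj] at h
    obtain ⟨ha, hb⟩ := mul_self_add_mul_self_eq_zero.1 h
    exact hab (Prod.ext ha hb)
  obtain ⟨Z, hZ, hzZ, hZY, hdim⟩ :=
    hW.exists_stratum_subset_closure hM.isClosed hconn hY hd hz
  obtain ⟨e, hed, he⟩ := hdim hzY
  obtain ⟨S, hS, hS1, hSZ, h⟩ := ih e hed Z hZ he ⟨z, hzZ, hzc⟩
  exact ⟨S, hS, hS1, hSZ.trans (closure_minimal hZY isClosed_closure), h⟩

end IsWhitneyStratification

lemma image_coord_subset_of_subset_closure {X S : Set (EuclideanSpace ℝ (Fin n))} {k : Fin n}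
    (hX : IsConnected X) (hSX : S ⊆ closure X)
    (hS : ∀ p ∈ S, ∃ v ∈ tangentSpace S p, v k ≠ 0) :
    (fun x : EuclideanSpace ℝ (Fin n) => x k) '' S ⊆
      (fun x : EuclideanSpace ℝ (Fin n) => x k) '' X := by
  rintro _ ⟨p, hp, rfl⟩
  by_contra hcon
  have hpre := hX.isPreconnected.image _ (continuous_coord k).continuousOn
  have hext : (∀ x ∈ X, p k ≤ x k) ∨ ∀ x ∈ X, x k ≤ p k := by
    simpa [forall_mem_image] using
      le_or_ge_of_notMem_interior hpre fun h => hcon (interior_subset h)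
  obtain ⟨v, hv, hvk⟩ := hS p hp
  exact hvk (IsLocalExtrOn.coord_eq_zero (isLocalExtrOn_of_le
    ((le_on_closure hext).imp (fun h x hx => h x (hSX hx)) (fun h x hx => h x (hSX hx)))) hv)

end MonotonicStratification

/-! ### Choice of the two families of strata. -/

theorem lemma1p5 {n : ℕ} (M : Set (EuclideanSpace ℝ (Fin n)))
    (𝓜 : Set (Set (EuclideanSpace ℝ (Fin n))))
    (hM : IsCompact M)
    (hW : MonotonicStratification.IsWhitneyStratification 𝓜 M)
    (hmono : ∀ S ∈ 𝓜, MonotonicStratification.IsMonotonic S)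
    (hconn : ∀ S ∈ 𝓜, IsConnected S)
    (k : Fin n)
    (𝓜' : Set (Set (EuclideanSpace ℝ (Fin n)))) (h𝓜' : 𝓜' ⊆ 𝓜) :
    ∃ T P : Set (Set (EuclideanSpace ℝ (Fin n))),
      T ⊆ 𝓜 ∧ (∀ S ∈ T, MonotonicStratification.IsSubmanifold 1 S) ∧
      P ⊆ 𝓜 ∧ (∀ S ∈ P, MonotonicStratification.IsSubmanifold 0 S) ∧
      (∀ S ∈ T, ∀ p ∈ S,
        MonotonicStratification.rankAt
          (EuclideanSpace.projₗ (𝕜 := ℝ) k) S p = 1) ∧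
      (∀ S ∈ T, frontier (EuclideanSpace.projₗ (𝕜 := ℝ) k '' S) ⊆
        EuclideanSpace.projₗ (𝕜 := ℝ) k '' MonotonicStratification.skeleton 𝓜 0) ∧
      Disjoint (EuclideanSpace.projₗ (𝕜 := ℝ) k '' ⋃₀ T)
        (EuclideanSpace.projₗ (𝕜 := ℝ) k '' ⋃₀ P) ∧
      EuclideanSpace.projₗ (𝕜 := ℝ) k '' ⋃₀ T ∪
          EuclideanSpace.projₗ (𝕜 := ℝ) k '' ⋃₀ P =
        EuclideanSpace.projₗ (𝕜 := ℝ) k '' ⋃₀ 𝓜' := by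
  have hproj : ∀ A : Set (EuclideanSpace ℝ (Fin n)),
      EuclideanSpace.projₗ (𝕜 := ℝ) k '' A = (fun x : EuclideanSpace ℝ (Fin n) => x k) '' A :=
    fun A => rfl
  simp only [hproj]
  set π : EuclideanSpace ℝ (Fin n) → ℝ := fun x => x k with hπ
  set T : Set (Set (EuclideanSpace ℝ (Fin n))) :=
    {S | S ∈ 𝓜 ∧ MonotonicStratification.IsSubmanifold 1 S ∧
      (∀ p ∈ S, ∃ v ∈ MonotonicStratification.tangentSpace S p, v k ≠ 0) ∧
      π '' S ⊆ π '' ⋃₀ 𝓜'} with hT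
  -- Both families are taken as large as possible; removing the values of `T` here gives
  -- disjointness directly.
  set P : Set (Set (EuclideanSpace ℝ (Fin n))) :=
    {S | S ∈ 𝓜 ∧ MonotonicStratification.IsSubmanifold 0 S ∧
      π '' S ⊆ π '' ⋃₀ 𝓜' \ π '' ⋃₀ T} with hP
  refine ⟨T, P, fun S hS => hS.1, fun S hS => hS.2.1, fun S hS => hS.1, fun S hS => hS.2.1,
    fun S hS p hp => MonotonicStratification.rankAt_projₗ_eq_one (hS.2.2.1 p hp),
    fun S hS => hW.frontier_image_subset hM hmono hconn k hS.1, ?_, ?_⟩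
  · rw [disjoint_left]
    rintro c hcT ⟨p, ⟨S, hS, hpS⟩, rfl⟩
    exact (hS.2.2 (mem_image_of_mem π hpS)).2 hcT
  · apply Subset.antisymm
    · rintro c (⟨p, ⟨S, hS, hpS⟩, rfl⟩ | ⟨p, ⟨S, hS, hpS⟩, rfl⟩)
      · exact hS.2.2.2 (mem_image_of_mem π hpS)
      · exact (hS.2.2 (mem_image_of_mem π hpS)).1
    · intro c hc
      by_cases hcT : c ∈ π '' ⋃₀ T
      · exact Or.inl hcT
      by_cases hc0 : ∃ q ∈ MonotonicStratification.skeleton 𝓜 0, q k = c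
      · right
        obtain ⟨q, ⟨S, ⟨hS, e, he, hS0⟩, hqS⟩, rfl⟩ := hc0
        obtain rfl : e = 0 := Nat.le_zero.1 he
        refine ⟨q, ⟨S, ⟨hS, hS0, ?_⟩, hqS⟩, rfl⟩
        rintro _ ⟨x, hx, rfl⟩
        -- A connected zero-dimensional stratum has a single value, so it qualifies for `P` as soon
        -- as `c` does.
        have hxq : π x = q k := hS0.coord_eq (hconn S hS).isPreconnected
          (fun p hp v hv => by rw [hS0.eq_zero_of_mem_tangentSpace hp hv]; rfl) hx hqS
        rw [hxq]
        exact ⟨hc, hcT⟩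
      · left
        push Not at hc0
        obtain ⟨x, ⟨X, hX', hxX⟩, hxc⟩ := hc
        have hX := h𝓜' hX'
        obtain ⟨d, hd⟩ := hW.isSubmanifold X hX
        obtain ⟨S, hS, hS1, hSX, ⟨p, hp, hpc⟩, hSk⟩ :=
          hW.exists_one_dim_stratum hM hmono hconn k c hc0 d X hX hd ⟨x, hxX, hxc⟩
        refine ⟨p, ⟨S, ⟨hS, hS1, hSk, ?_⟩, hp⟩, hpc⟩
        exact (MonotonicStratification.image_coord_subset_of_subset_closure (hconn X hX) hSX
          hSk).trans (image_mono (subset_sUnion_of_mem hX'))
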